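/- Let $\mathbb{F}$ be an arbitrary field (of any characteristic, $2$ included) with algebraic closure $\overline{\mathbb{F}}$, and let $p,q\in\mathbb{F}[t]$ be monic irreducible polynomials of degree $2$ that have the same splitting field in $\overline{\mathbb{F}}$. Write $\mathrm{Root}(p)$, $\mathrm{Root}(q)$ for their sets of roots in $\overline{\mathbb{F}}$, $\mathrm{Root}(p)-\mathrm{Root}(q)=\{x-y : x\in\mathrm{Root}(p),\ y\in\mathrm{Root}(q)\}$, and let $F_{p,q}(t):=\mathrm{res}_{\mathbb{F}[t]}\bigl(p(x),q(x-t)\bigr)\in\mathbb{F}[t]$ be the resultant with respect to $x$; that is, $F_{p,q}(t)=\prod_{1\le i,j\le 2}\bigl(t-(x_i-y_j)\bigr)$ if $p=(t-x_1)(t-x_2)$ and $q=(t-y_1)(t-y_2)$ over $\overline{\mathbb{F}}$. Let $V$ be a finite-dimensional vector space over $\mathbb{F}$. Given a bilinear form $b$ on $V$, an endomorphism $w$ of $V$ is called $b$-alternating if $b(x,w(x))=0$ for all $x\in V$. Let $(b,u)$ be a symplectic pair on $V$, i.e. $b$ is a nondegenerate alternating bilinear form on $V$ and $u$ is a $b$-alternating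 endomorphism of $V$. Assume that $(b,u)$ is $(p,q)$-exceptional, i.e. $V=\bigcup_{n\in\mathbb{N}}\ker F_{p,q}(u)^n$ (equivalently, all the eigenvalues of $u$ in $\overline{\mathbb{F}}$ belong to $\mathrm{Root}(p)-\mathrm{Root}(q)$). Then the following two conditions are equivalent: (i) $(b,u)$ is a symplectic $(p,q)$-difference, i.e. there exist $b$-alternating endomorphisms $u_1,u_2$ of $V$ such that $p(u_1)=q(u_2)=0$ and $u=u_1-u_2$; (ii) for every $z\in\mathbb{F}\cap(\mathrm{Root}(p)-\mathrm{Root}(q))$ and every odd integer $k\ge 1$, the number of Jordan cells of $u$ of size $k$ for the eigenvalue $z$ is a multiple of $4$. Here this number is $n_k(u,z)-n_{k+1}(u,z)$, where $n_k(u,z):=\dim\ker(u-z\,\mathrm{id}_V)^k-\dim\ker(u-z\,\mathrm{id}_V)^{k-1}$ is the number of cells of size at least $k$. -/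

import Mathlib

open Polynomial

/-- A symplectic pair `(b, u)`: a symplectic (alternating, nondegenerate) bilinear form `b` on `V`
together with a `b`-alternating endomorphism `u`, i.e. `b (x, u x) = 0` for all `x`. -/
structure IsSymplecticPair {F V : Type*} [Field F] [AddCommGroup V] [Module F V]
    (b : LinearMap.BilinForm F V) (u : Module.End F V) : Prop where
  isAlt : b.IsAlt
  nondegenerate : b.Nondegenerate
  alternating : ∀ x : V, b x (u x) = 0

/-- `u` is the difference of two `b`-alternating endomorphisms, the first one annihilated by `p`
and the second one annihilated by `q`. -/
def IsSymplecticDifference {F V : Type*} [Field F] [AddCommGroup V] [Module F V]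
    (p q : F[X]) (b : LinearMap.BilinForm F V) (u : Module.End F V) : Prop :=
  IsSymplecticPair b u ∧
    ∃ u₁ u₂ : Module.End F V,
      (∀ x : V, b x (u₁ x) = 0) ∧ (∀ x : V, b x (u₂ x) = 0) ∧
        aeval u₁ p = 0 ∧ aeval u₂ q = 0 ∧ u = u₁ - u₂

/-- The fundamental polynomial `F_{p,q}(t) = res_{F[t]} (p(x), q(x - t))` of the pair `(p, q)`.
Here the outer variable of `F[X][X]` is `x` and the inner one is `t`. -/
noncomputable def fundamentalPolynomial {F : Type*} [Field F] (p q : F[X]) : F[X] :=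
  resultant (p.map (C : F →+* F[X])) ((q.map (C : F →+* F[X])).comp (X - C X))

/-- `u` is `(p, q)`-exceptional: the union over `n` of the increasing sequence of subspaces
`ker (F_{p,q}(u) ^ n)` is the whole space. -/
def IsExceptional {F V : Type*} [Field F] [AddCommGroup V] [Module F V]
    (p q : F[X]) (u : Module.End F V) : Prop :=
  ⨆ n : ℕ, LinearMap.ker ((aeval u (fundamentalPolynomial p q)) ^ n) = ⊤

/-- For `k ≥ 1`, the number of Jordan cells of `u` of size at least `k` for the eigenvalue `z`:
`dim ker (u - z)^k - dim ker (u - z)^(k-1)`. -/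
noncomputable def jordanCellsGE {F V : Type*} [Field F] [AddCommGroup V] [Module F V]
    (u : Module.End F V) (z : F) (k : ℕ) : ℕ :=
  Module.finrank F (LinearMap.ker ((u - algebraMap F (Module.End F V) z) ^ k)) -
    Module.finrank F (LinearMap.ker ((u - algebraMap F (Module.End F V) z) ^ (k - 1)))

/-- For `k ≥ 1`, the number of Jordan cells of `u` of size exactly `k` for the eigenvalue `z`
(the number of those of size at least `k`, minus the number of those of size at least `k + 1`;
in finite dimension neither this subtraction nor the previous one is ever truncated, see
`jordanCells_add` below). -/
noncomputable def jordanCells {F V : Type*} [Field F] [AddCommGroup V] [Module F V]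
    (u : Module.End F V) (z : F) (k : ℕ) : ℕ :=
  jordanCellsGE u z k - jordanCellsGE u z (k + 1)

theorem finrank_ker_pow_add {F V : Type*} [Field F] [AddCommGroup V] [Module F V]
    [FiniteDimensional F V] (f : Module.End F V) (k : ℕ) :
    Module.finrank F (LinearMap.ker (f ^ k)) + Module.finrank F (LinearMap.ker (f ^ (k + 2))) ≤
      2 * Module.finrank F (LinearMap.ker (f ^ (k + 1))) := by
  -- the restriction of `f ^ j` to `ker (f ^ (j+1))` has kernel `ker (f ^ j)` 
  have key : ∀ j, Module.finrank F (LinearMap.ker (f ^ (j + 1))) =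
      Module.finrank F (Submodule.map (f ^ j) (LinearMap.ker (f ^ (j + 1)))) +
        Module.finrank F (LinearMap.ker (f ^ j)) := by
    intro j
    have h := LinearMap.finrank_range_add_finrank_ker
      ((f ^ j).domRestrict (LinearMap.ker (f ^ (j + 1))))
    rw [LinearMap.range_domRestrict, LinearMap.ker_domRestrict] at h
    have hle : LinearMap.ker (f ^ j) ≤ LinearMap.ker (f ^ (j + 1)) := by
      intro x hx
      simp only [LinearMap.mem_ker] at hx ⊢
      rw [pow_succ', Module.End.mul_apply, hx, map_zero]
    rw [← h, ← LinearEquiv.finrank_eq (Submodule.comapSubtypeEquivOfLe hle)]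
  have h1 := key k
  have h2 := key (k + 1)
  have h3 : Module.finrank F (Submodule.map (f ^ (k + 1)) (LinearMap.ker (f ^ (k + 1 + 1)))) ≤
      Module.finrank F (Submodule.map (f ^ k) (LinearMap.ker (f ^ (k + 1)))) := by
    apply Submodule.finrank_mono
    rintro _ ⟨x, hx, rfl⟩
    refine ⟨f x, ?_, ?_⟩
    · simp only [SetLike.mem_coe, LinearMap.mem_ker] at hx ⊢
      rw [← Module.End.mul_apply, ← pow_succ]; exact hx
    · rw [← Module.End.mul_apply, ← pow_succ]
  have e : k + 2 = k + 1 + 1 := rfl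
  rw [e]
  omega

theorem finrank_ker_pow_mono {F V : Type*} [Field F] [AddCommGroup V] [Module F V]
    [FiniteDimensional F V] (f : Module.End F V) (k : ℕ) :
    Module.finrank F (LinearMap.ker (f ^ k)) ≤ Module.finrank F (LinearMap.ker (f ^ (k + 1))) := by
  apply Submodule.finrank_mono
  intro x hx
  simp only [LinearMap.mem_ker] at hx ⊢
  rw [pow_succ', Module.End.mul_apply, hx, map_zero]

/-- For `k ≥ 1`, the subtractions in `jordanCells` are not truncated. -/
theorem jordanCells_add {F V : Type*} [Field F] [AddCommGroup V] [Module F V]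
    [FiniteDimensional F V] (u : Module.End F V) (z : F) (k : ℕ) (hk : 1 ≤ k) :
    jordanCells u z k
        + Module.finrank F (LinearMap.ker ((u - algebraMap F (Module.End F V) z) ^ (k + 1)))
        + Module.finrank F (LinearMap.ker ((u - algebraMap F (Module.End F V) z) ^ (k - 1)))
      = 2 * Module.finrank F (LinearMap.ker ((u - algebraMap F (Module.End F V) z) ^ k)) := by
  obtain ⟨j, rfl⟩ : ∃ j, k = j + 1 := ⟨k - 1, by omega⟩
  have h1 := finrank_ker_pow_add (u - algebraMap F (Module.End F V) z) j
  have h2 := finrank_ker_pow_mono (u - algebraMap F (Module.End F V) z) j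
  have h3 := finrank_ker_pow_mono (u - algebraMap F (Module.End F V) z) (j + 1)
  have e : j + 2 = j + 1 + 1 := rfl
  rw [e] at h1
  have e1 : ∀ i, jordanCellsGE u z (i + 1) =
      Module.finrank F (LinearMap.ker ((u - algebraMap F (Module.End F V) z) ^ (i + 1))) -
        Module.finrank F (LinearMap.ker ((u - algebraMap F (Module.End F V) z) ^ i)) :=
    fun _ => rfl
  change jordanCells u z (j + 1) + _ +
    Module.finrank F (LinearMap.ker ((u - algebraMap F (Module.End F V) z) ^ j)) = _
  rw [jordanCells, e1, e1]
  omega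

/-!
Write `p = X² - l X + c`, `q = X² - m X + d`, and call `z` in the base field *special* when it is a
difference of a root of `p` and a root of `q`; equivalently, `p` is the translate by `z` of `q`.

**Differences have fourfold odd cells.** For `z` special, `N = u - z = u₁ - u₂'` is a difference of
two alternating roots of the same polynomial `p`. Then `N` intertwines each of them with the
conjugate of the other, so `u₁` commutes with `N²` and is alternating for the form
`b (x, N ^ (2 j) y)`. A maximal totally isotropic `u₁`-stable subspace `W` for this form is its own
orthogonal, which gives `rank N ^ (2 j) = 2 (dim V - dim W)`, and both dimensions are even as `V`
and `W` are vector spaces over the field `F[X] / (p)`. So the even powers of `N` have rank divisible by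
`4`, while all powers have even rank, and the number of cells of odd size `k` is
`rank N ^ (k + 1) + rank N ^ (k - 1) - 2 rank N ^ k` (`four_dvd_jordanCells`).

**Reconstruction.** Let `r` be an irreducible factor of the minimal polynomial of `u`, with
multiplicity `n`. Since `u` is exceptional and `p`, `q` have the same splitting field, either
`r = X - z` with `z` special, or `r = X² - (l - m) X + t` for some `t`
(`IsExceptional.hasExceptionalFactors`). A vector of order `r ^ n` together with a suitable dual
vector spans a nondegenerate stable subspace, isometric to the double of multiplication by `X` on
`F[X] / (r ^ n)`. If `deg r = 2`, or if `deg r = 1` and `n` is even, this double is itself a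
difference, by explicit formulas (`isQuadraticDifference_quadraticForm` and
`isQuadraticDifference_hyperbolicForm`). If `deg r = 1` and `n` is odd, the sum of two copies of it
is a difference (`isQuadraticDifference_hyperbolicForm_prod`), and the hypothesis on the cells
provides a second copy in the orthogonal complement. The summand, being a difference, has fourfold
odd cells by the first part, hence so has its orthogonal complement, and an induction on the
dimension concludes (`IsSymplecticPair.isQuadraticDifference`).
-/

/-! ### Alternating forms and stable Lagrangian subspaces -/

section Lagrangian

variable {F V : Type*} [Field F] [AddCommGroup V] [Module F V]

theorem LinearMap.BilinForm.IsAlt.apply_left_eq_apply_right {B : LinearMap.BilinForm F V}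
    (hB : B.IsAlt) {a : Module.End F V} (ha : ∀ x, B x (a x) = 0) (x y : V) :
    B (a x) y = B x (a y) := by
  have h := ha (x + y)
  simp only [map_add, LinearMap.add_apply, ha, zero_add, add_zero] at h
  have h2 := hB.neg_eq (a x) y
  rw [← h2, neg_add_eq_zero] at h
  exact h

theorem apply_pow_left {B : LinearMap.BilinForm F V} {a : Module.End F V}
    (ha : ∀ x y, B (a x) y = B x (a y)) (n : ℕ) (x y : V) :
    B ((a ^ n) x) y = B x ((a ^ n) y) := by
  induction n generalizing x y with
  | zero => simp
  | succ n ih => rw [pow_succ, Module.End.mul_apply, ih, ha, ← Module.End.mul_apply, ← pow_succ',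
      pow_succ]

theorem apply_aeval_left {B : LinearMap.BilinForm F V} {a : Module.End F V}
    (ha : ∀ x y, B (a x) y = B x (a y)) (f : F[X]) (x y : V) :
    B (aeval a f x) y = B x (aeval a f y) := by
  induction f using Polynomial.induction_on' with
  | add f g hf hg => simp [hf, hg]
  | monomial n c =>
    simp [aeval_monomial, Module.algebraMap_end_apply, apply_pow_left ha]

/-- Every power of an alternating endomorphism is again alternating. -/
theorem LinearMap.BilinForm.IsAlt.apply_pow_self {B : LinearMap.BilinForm F V}
    (hB : B.IsAlt) {a : Module.End F V} (ha : ∀ x, B x (a x) = 0) (n : ℕ) (x : V) :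
    B x ((a ^ n) x) = 0 := by
  have hs := apply_pow_left (hB.apply_left_eq_apply_right ha)
  obtain ⟨k, rfl | rfl⟩ := n.even_or_odd'
  · rw [two_mul, pow_add, Module.End.mul_apply, ← hs]
    exact hB _
  · rw [add_comm, two_mul, ← add_assoc, add_comm, pow_add, Module.End.mul_apply, ← hs, add_comm,
      pow_succ', Module.End.mul_apply]
    exact ha _

theorem LinearMap.BilinForm.IsAlt.apply_aeval_self {B : LinearMap.BilinForm F V}
    (hB : B.IsAlt) {a : Module.End F V} (ha : ∀ x, B x (a x) = 0) (f : F[X]) (x : V) :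
    B x (aeval a f x) = 0 := by
  induction f using Polynomial.induction_on' with
  | add f g hf hg => simp [hf, hg]
  | monomial n c =>
    simp [aeval_monomial, Module.algebraMap_end_apply, hB.apply_pow_self ha]

/-- A maximal totally isotropic subspace stable under an alternating endomorphism `a` is its own
orthogonal: for `x` orthogonal to `W`, the subspace `W + F[a] x` is again totally isotropic. -/
theorem LinearMap.BilinForm.IsAlt.exists_stable_orthogonal_eq [FiniteDimensional F V]
    {B : LinearMap.BilinForm F V}
    (hB : B.IsAlt) {a : Module.End F V} (ha : ∀ x, B x (a x) = 0) :
    ∃ W : Submodule F V, (∀ x ∈ W, a x ∈ W) ∧ B.orthogonal W = W := by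
  have hs := hB.apply_left_eq_apply_right ha
  obtain ⟨W, ⟨hW1, hW2⟩, hmax⟩ := (wellFounded_gt (α := Submodule F V)).has_min
    {W | (∀ x ∈ W, a x ∈ W) ∧ W ≤ B.orthogonal W} ⟨⊥, by simp, bot_le⟩
  refine ⟨W, hW1, le_antisymm (fun x hx => ?_) hW2⟩
  have hx' : ∀ w ∈ W, B w x = 0 := fun w hw => hx w hw
  have hW1' : ∀ (f : F[X]), ∀ w ∈ W, aeval a f w ∈ W := by
    intro f w hw
    induction f using Polynomial.induction_on' with
    | add f g hf hg => simpa using W.add_mem hf hg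
    | monomial n c =>
      simp only [aeval_monomial, Module.End.mul_apply, Module.algebraMap_end_apply]
      refine W.smul_mem _ ?_
      induction n with
      | zero => simpa
      | succ n ih => rw [pow_succ', Module.End.mul_apply]; exact hW1 _ ih
  -- the cyclic subspace `F[a] x`
  set C : Submodule F V := LinearMap.range ((LinearMap.applyₗ x).comp (aeval a).toLinearMap)
    with hC
  have hCmem : ∀ y, y ∈ C ↔ ∃ f : F[X], aeval a f x = y := by
    intro y; simp [hC]
  have hWC : W ⊔ C ∈ {W : Submodule F V | (∀ x ∈ W, a x ∈ W) ∧ W ≤ B.orthogonal W} := by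
    constructor
    · intro y hy
      obtain ⟨w, hw, c, hc, rfl⟩ := Submodule.mem_sup.1 hy
      obtain ⟨f, rfl⟩ := (hCmem _).1 hc
      rw [map_add]
      refine Submodule.add_mem_sup (hW1 w hw) ((hCmem _).2 ⟨X * f, ?_⟩)
      simp
    · intro y hy z hz
      obtain ⟨w, hw, c, hc, rfl⟩ := Submodule.mem_sup.1 hy
      obtain ⟨w', hw', c', hc', rfl⟩ := Submodule.mem_sup.1 hz
      obtain ⟨f, rfl⟩ := (hCmem _).1 hc
      obtain ⟨g, rfl⟩ := (hCmem _).1 hc'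
      have h1 : B w' w = 0 := hW2 hw w' hw'
      have h2 : B w' (aeval a f x) = 0 := by
        rw [← apply_aeval_left hs]; exact hx' _ (hW1' f _ hw')
      have h3 : B (aeval a g x) w = 0 := by
        rw [apply_aeval_left hs, hB.isRefl.eq_zero (hx' _ (hW1' g _ hw))]
      have h4 : B (aeval a g x) (aeval a f x) = 0 := by
        rw [apply_aeval_left hs, ← Module.End.mul_apply, ← map_mul]
        exact hB.apply_aeval_self ha _ _
      change B _ _ = 0
      simp [h1, h2, h3, h4]
  have hle : W ⊔ C ≤ W := by
    by_contra hne
    exact hmax _ hWC (lt_of_le_not_ge le_sup_left hne)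
  exact hle (Submodule.mem_sup_right ((hCmem x).2 ⟨1, by simp⟩))

/-- If `f` is self-adjoint for the symplectic form `b` and `a` is alternating for the form
`b (x, f y)`, then the rank of `f` is twice the codimension of some `a`-stable subspace. -/
theorem exists_stable_finrank_range [FiniteDimensional F V]
    {b : LinearMap.BilinForm F V} (hb : b.Nondegenerate)
    {f a : Module.End F V} (hf : ∀ x, b x (f x) = 0) (ha : ∀ x, b x (f (a x)) = 0) :
    ∃ W : Submodule F V, (∀ x ∈ W, a x ∈ W) ∧
      Module.finrank F (LinearMap.range f) + 2 * Module.finrank F W = 2 * Module.finrank F V := by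
  have hB : LinearMap.BilinForm.IsAlt (LinearMap.compl₂ b f) := fun x => by simpa using hf x
  obtain ⟨W, hW, hWW⟩ := hB.exists_stable_orthogonal_eq (a := a) (by simpa using ha)
  refine ⟨W, hW, ?_⟩
  have h := LinearMap.BilinForm.finrank_add_finrank_orthogonal hB.isRefl W
  have hker : LinearMap.BilinForm.orthogonal (LinearMap.compl₂ b f) ⊤ = LinearMap.ker f := by
    ext x
    simp only [LinearMap.BilinForm.mem_orthogonal_iff, Submodule.mem_top, true_implies,
      LinearMap.compl₂_apply, LinearMap.mem_ker]
    exact ⟨fun h => hb.2 _ h, fun h y => by simp [h]⟩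
  have hle : LinearMap.ker f ≤ W := by
    rw [← hker, ← hWW]
    exact LinearMap.BilinForm.orthogonal_le le_top
  rw [hker, hWW, inf_eq_right.2 hle] at h
  have h2 := LinearMap.finrank_range_add_finrank_ker f
  omega

/-- A subspace stable under `a`, where `p (a) = 0` with `p` irreducible of degree `2`, is a vector
space over the quadratic extension `F[X] / (p)`, so it has even dimension. -/
theorem even_finrank_of_aeval_eq_zero {p : F[X]} (hirr : Irreducible p) (hdeg : p.natDegree = 2)
    {a : Module.End F V} (ha : aeval a p = 0) : Even (Module.finrank F V) := by
  have : Fact (Irreducible p) := ⟨hirr⟩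
  let φ : AdjoinRoot p →ₐ[F] Module.End F V := Ideal.Quotient.liftₐ _ (aeval a) (by
    intro f hf
    obtain ⟨g, rfl⟩ := Ideal.mem_span_singleton.1 hf
    rw [map_mul, ha, zero_mul])
  let _ : Module (AdjoinRoot p) V := Module.compHom V φ.toRingHom
  have : IsScalarTower F (AdjoinRoot p) V := ⟨fun c x v => by
    change φ (c • x) v = c • φ x v
    simp⟩
  have h := Module.finrank_mul_finrank F (AdjoinRoot p) V
  rw [(AdjoinRoot.powerBasis hirr.ne_zero).finrank, AdjoinRoot.powerBasis_dim, hdeg] at h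
  exact ⟨_, by rw [← h, two_mul]⟩

theorem even_finrank_of_stable {p : F[X]} (hirr : Irreducible p) (hdeg : p.natDegree = 2)
    {a : Module.End F V} (ha : aeval a p = 0) {W : Submodule F V} (hW : ∀ x ∈ W, a x ∈ W) :
    Even (Module.finrank F W) := by
  refine even_finrank_of_aeval_eq_zero hirr hdeg (a := a.restrict hW) ?_
  have key : ∀ (f : F[X]) (x : W), ((aeval (a.restrict hW) f x : W) : V) = aeval a f x := by
    intro f x
    induction f using Polynomial.induction_on' with
    | add f g hf hg => simp [hf, hg]
    | monomial n c =>
      simp only [aeval_monomial, Module.End.mul_apply, Module.algebraMap_end_apply,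
        Submodule.coe_smul]
      congr 1
      rw [Module.End.pow_restrict]
      rfl
  ext x
  rw [key, ha]; rfl

end Lagrangian

/-! ### Jordan cells of a difference -/

section JordanCells

variable {F V : Type*} [Field F] [AddCommGroup V] [Module F V]

/-- The number of Jordan cells of size `k` in terms of the ranks of the powers. -/
theorem jordanCells_add_finrank_range [FiniteDimensional F V] (u : Module.End F V) (z : F) (k : ℕ)
    (hk : 1 ≤ k) :
    jordanCells u z k
      + 2 * Module.finrank F (LinearMap.range ((u - algebraMap F (Module.End F V) z) ^ k))
      = Module.finrank F (LinearMap.range ((u - algebraMap F (Module.End F V) z) ^ (k + 1)))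
      + Module.finrank F (LinearMap.range ((u - algebraMap F (Module.End F V) z) ^ (k - 1))) := by
  have h := jordanCells_add u z k hk
  have h1 := LinearMap.finrank_range_add_finrank_ker ((u - algebraMap F (Module.End F V) z) ^ k)
  have h2 := LinearMap.finrank_range_add_finrank_ker
    ((u - algebraMap F (Module.End F V) z) ^ (k + 1))
  have h3 := LinearMap.finrank_range_add_finrank_ker
    ((u - algebraMap F (Module.End F V) z) ^ (k - 1))
  omega

/-- If `N = u₁ - u₂` with `u₁`, `u₂` roots of the same polynomial `X² - l X + c`, then `N` exchanges
`u₁` with the conjugate `l - u₂` and `u₂` with `l - u₁`; hence `u₁` commutes with `N²` and is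
alternating for the form `b (x, N ^ (2 j) y)`. -/
theorem apply_pow_two_mul_apply_self {b : LinearMap.BilinForm F V} (hb : b.IsAlt)
    {u₁ u₂ : Module.End F V} (h₁ : ∀ x, b x (u₁ x) = 0) (h₂ : ∀ x, b x (u₂ x) = 0) {l c : F}
    (e₁ : u₁ * u₁ = l • u₁ - c • 1) (e₂ : u₂ * u₂ = l • u₂ - c • 1) (j : ℕ) (x : V) :
    b x (((u₁ - u₂) ^ (2 * j)) (u₁ x)) = 0 := by
  set N := u₁ - u₂ with hN
  have hNalt : ∀ x, b x (N x) = 0 := fun x => by simp [hN, h₁, h₂]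
  -- `N` intertwines `u₁` with the conjugate of `u₂`, and conversely
  have r1 : N * u₁ = (l • 1 - u₂) * N := by
    simp only [hN, sub_mul, mul_sub, e₁, e₂, smul_mul_assoc, one_mul]; module
  have r2 : N * (l • 1 - u₂) = u₁ * N := by
    simp only [hN, sub_mul, mul_sub, e₁, e₂, mul_smul_comm, mul_one]; module
  have r3 : ∀ i, N ^ (2 * i) * u₁ = u₁ * N ^ (2 * i) := by
    intro i
    have : Commute (N ^ 2) u₁ := by
      rw [Commute, SemiconjBy, pow_two, mul_assoc, r1, ← mul_assoc, r2, mul_assoc]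
    rw [pow_mul]; exact (this.pow_left i)
  rw [two_mul, pow_add, Module.End.mul_apply, ← apply_pow_left (hb.apply_left_eq_apply_right hNalt)]
  obtain ⟨i, rfl | rfl⟩ := j.even_or_odd'
  · rw [← Module.End.mul_apply _ u₁, r3, Module.End.mul_apply]
    exact h₁ _
  · rw [← Module.End.mul_apply _ u₁, pow_succ', mul_assoc, r3, ← mul_assoc, r1, mul_assoc,
      ← pow_succ', Module.End.mul_apply]
    simp [h₂, hb.self_eq_zero]

/-- For odd `k`, the number of Jordan cells of size `k` is a multiple of `4` for a difference of
two alternating roots of the same irreducible quadratic polynomial: the rank of `(u₁ - u₂) ^ k` is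
always even, and it is a multiple of `4` when `k` is even. -/
theorem four_dvd_jordanCells [FiniteDimensional F V]
    {b : LinearMap.BilinForm F V} (hb : b.IsAlt) (hnd : b.Nondegenerate)
    {p : F[X]} (hirr : Irreducible p) (hdeg : p.natDegree = 2) {u u₁ u₂ : Module.End F V} {z : F}
    (h₁ : ∀ x, b x (u₁ x) = 0) (h₂ : ∀ x, b x (u₂ x) = 0) {l c : F} (hp : p = X ^ 2 - C l * X + C c)
    (e₁ : aeval u₁ p = 0) (e₂ : aeval u₂ p = 0) (hu : u - algebraMap F (Module.End F V) z = u₁ - u₂)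
    {k : ℕ} (hk : Odd k) : 4 ∣ jordanCells u z k := by
  obtain ⟨j, rfl⟩ := hk
  have h := jordanCells_add_finrank_range u z (2 * j + 1) (by omega)
  have conv : ∀ a : Module.End F V, aeval a p = 0 → a * a = l • a - c • 1 := by
    intro a ha
    rw [hp] at ha
    simp only [map_add, map_sub, map_pow, map_mul, aeval_X, aeval_C] at ha
    rw [← Algebra.smul_def, Algebra.algebraMap_eq_smul_one, pow_two] at ha
    rw [← sub_eq_zero, ← ha]; abel
  rw [hu] at h
  have hNalt : ∀ x, b x ((u₁ - u₂) x) = 0 := fun x => by simp [h₁, h₂]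
  have four : ∀ i, 4 ∣ Module.finrank F (LinearMap.range ((u₁ - u₂) ^ (2 * i))) := by
    intro i
    obtain ⟨W, hW, hd⟩ := exists_stable_finrank_range hnd (f := (u₁ - u₂) ^ (2 * i)) (a := u₁)
      (hb.apply_pow_self hNalt _)
      (apply_pow_two_mul_apply_self hb h₁ h₂ (conv _ e₁) (conv _ e₂) i)
    obtain ⟨m, hm⟩ := even_finrank_of_stable hirr hdeg e₁ hW
    obtain ⟨m', hm'⟩ := even_finrank_of_aeval_eq_zero hirr hdeg e₁
    omega
  have two : Even (Module.finrank F (LinearMap.range ((u₁ - u₂) ^ (2 * j + 1)))) := by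
    -- for odd exponents `u₁` need not be alternating for the form, so no stability is asked
    obtain ⟨W, hW, hd⟩ := exists_stable_finrank_range hnd (f := (u₁ - u₂) ^ (2 * j + 1)) (a := 0)
      (hb.apply_pow_self hNalt _) (by simp)
    exact ⟨Module.finrank F V - Module.finrank F W, by omega⟩
  obtain ⟨m, hm⟩ := two
  have f1 := four (j + 1)
  have f2 := four j
  rw [show 2 * (j + 1) = 2 * j + 1 + 1 by ring] at f1
  rw [show 2 * j + 1 - 1 = 2 * j by omega] at h
  omega

end JordanCells

/-! ### Differences of quadratic endomorphisms, and model pairs -/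

section Models

variable {F : Type*} [Field F]

/-- `u = a - a'` for some `b`-alternating endomorphism `a` with `a² = l a - c` and some `a'` with
`a'² = m a' - d`. The second endomorphism is encoded as `a - u`; that it is `b`-alternating is not
required, since this is automatic when `u` is `b`-alternating. -/
def IsQuadraticDifference {V : Type*} [AddCommGroup V] [Module F V] (l c m d : F)
    (b : LinearMap.BilinForm F V) (u : Module.End F V) : Prop :=
  ∃ a : Module.End F V, (∀ x, b x (a x) = 0) ∧ (∀ x, a (a x) = l • a x - c • x) ∧
    ∀ x, (a - u) ((a - u) x) = m • (a - u) x - d • x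

/-- Orthogonal sums of differences are differences. -/
theorem IsQuadraticDifference.of_orthogonal_sum {X V V' : Type*} [AddCommGroup X] [Module F X]
    [AddCommGroup V] [Module F V] [AddCommGroup V'] [Module F V'] {l c m d : F}
    {bX : LinearMap.BilinForm F X} {uX : Module.End F X}
    {b' : LinearMap.BilinForm F V'} {u' : Module.End F V'}
    {b : LinearMap.BilinForm F V} {u : Module.End F V} (e : (X × V') ≃ₗ[F] V)
    (hb : ∀ v w, b (e v) (e w) = bX v.1 w.1 + b' v.2 w.2)
    (hu : ∀ v, u (e v) = e (uX v.1, u' v.2))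
    (hX : IsQuadraticDifference l c m d bX uX) (h' : IsQuadraticDifference l c m d b' u') :
    IsQuadraticDifference l c m d b u := by
  obtain ⟨a, h1, h2, h3⟩ := hX
  obtain ⟨a', h1', h2', h3'⟩ := h'
  have ha : ∀ v, (e.toLinearMap ∘ₗ (a.prodMap a') ∘ₗ e.symm.toLinearMap) (e v) =
    e (a v.1, a' v.2) := fun v => by simp [LinearMap.prodMap_apply]
  refine ⟨e.toLinearMap ∘ₗ (a.prodMap a') ∘ₗ e.symm.toLinearMap, ?_, ?_, ?_⟩ <;>
    refine e.surjective.forall.2 fun v => ?_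
  · rw [ha, hb, h1, h1', add_zero]
  · rw [ha, ha, h2, h2', ← map_smul e, ← map_smul e, ← map_sub e]; rfl
  · have hd : ∀ v, ((e.toLinearMap ∘ₗ (a.prodMap a') ∘ₗ e.symm.toLinearMap) - u) (e v) =
        e ((a - uX) v.1, (a' - u') v.2) := fun v => by
      rw [LinearMap.sub_apply, ha, hu, ← map_sub]; rfl
    rw [hd, hd, h3, h3', ← map_smul e, ← map_smul e, ← map_sub e]; rfl

variable {W : Type*} [AddCommGroup W] [Module F W]

/-- The symplectic form `s x₁ y₂ - s x₂ y₁` on `W × W`, for a symmetric form `s`. -/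
noncomputable def hyperbolicForm (s : LinearMap.BilinForm F W) : LinearMap.BilinForm F (W × W) :=
  s.compl₁₂ (LinearMap.fst F W W) (LinearMap.snd F W W) -
    s.compl₁₂ (LinearMap.snd F W W) (LinearMap.fst F W W)

@[simp] theorem hyperbolicForm_apply (s : LinearMap.BilinForm F W) (v w : W × W) :
    hyperbolicForm s v w = s v.1 w.2 - s v.2 w.1 := rfl

/-- If the first polynomial is the translate by `z` of the second one, the double `W × W` of `N + z`
is a difference when there is a projector `P` such that `N` exchanges `P` and `1 - P` and whose
adjoint is `1 - P`: with `A` the companion matrix of the first polynomial and `A'` its adjugate,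
which is its adjoint for the standard symplectic form of `F²`, one takes
`(1 - P) ⊗ A + P ⊗ A' + N P ⊗ 1`. -/
theorem isQuadraticDifference_hyperbolicForm {s : LinearMap.BilinForm F W}
    (hs : ∀ x y, s x y = s y x) {N P : Module.End F W} (hN : ∀ x y, s (N x) y = s x (N y))
    (hP : ∀ x, P (P x) = P x) (hNP : ∀ x, N (P x) = N x - P (N x))
    (hPs : ∀ x y, s x (P y) = s x y - s (P x) y) {m d z : F} :
    IsQuadraticDifference (m + 2 * z) (z ^ 2 + m * z + d) m d (hyperbolicForm s)
      ((N + algebraMap F (Module.End F W) z).prodMap (N + algebraMap F (Module.End F W) z)) := by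
  set l := m + 2 * z with hl
  set c := z ^ 2 + m * z + d with hc
  have hPN : ∀ x, P (N x) = N x - N (P x) := fun x => by rw [hNP]; abel
  refine ⟨{ toFun := fun w => (l • P w.1 + c • (2 • P w.2 - w.2) + N (P w.1),
              w.1 - 2 • P w.1 + l • (w.2 - P w.2) + N (P w.2))
            map_add' := fun v w => by
              ext <;> simp only [Prod.fst_add, Prod.snd_add, map_add] <;> module
            map_smul' := fun r w => by
              ext <;> simp only [Prod.smul_fst, Prod.smul_snd, map_smul, RingHom.id_apply] <;>
                module }, ?_, ?_, ?_⟩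
  · rintro ⟨x, y⟩
    simp only [LinearMap.coe_mk, AddHom.coe_mk, hyperbolicForm_apply, map_add, map_sub, map_smul,
      map_nsmul, smul_eq_mul, nsmul_eq_mul]
    -- `s x (P x) = s x (x - P x)`, which avoids dividing by `2`
    have e1 := hPs x x
    rw [hs (P x) x] at e1
    have e2 := hPs y y
    rw [hs (P y) y] at e2
    have e3 := hPs x y
    have e4 : s x (N (P y)) = s y (N (P x)) := by
      rw [← hN, hPs, hPN, hs y, map_sub, LinearMap.sub_apply, sub_sub_cancel]
    rw [e4, hs y (P x)]
    linear_combination (-1 : F) * e1 - c * e2 - l * e3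
  · rintro ⟨x, y⟩
    ext <;> simp only [LinearMap.coe_mk, AddHom.coe_mk, map_add, map_sub, map_smul, map_nsmul, hP,
      hPN, Prod.fst_sub, Prod.snd_sub, Prod.smul_fst, Prod.smul_snd, map_zero, sub_self] <;> module
  · rintro ⟨x, y⟩
    ext <;> simp only [LinearMap.sub_apply, LinearMap.prodMap_apply, LinearMap.add_apply,
      Module.algebraMap_end_apply, LinearMap.coe_mk, AddHom.coe_mk, map_add, map_sub, map_smul,
      map_nsmul, hP, hPN, Prod.fst_sub, Prod.snd_sub, Prod.smul_fst, Prod.smul_snd, map_zero,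
      sub_self, hl, hc] <;> module

/-- If the first polynomial is the translate by `z` of the second one, two copies of the double of
`N + z` form a difference when there is a self-adjoint projector `P` exchanged with `1 - P` by `N`:
write the sum as `M ⊕ M*` with `M = W ⊗ F²` and take the endomorphism
`(1 - P) ⊗ A + P ⊗ A' + N P ⊗ 1` on `M` (`A` the companion matrix, `A'` its adjugate) and its
transpose on `M*`. -/
theorem isQuadraticDifference_hyperbolicForm_prod {s : LinearMap.BilinForm F W}
    (hs : ∀ x y, s x y = s y x) {N P : Module.End F W} (hN : ∀ x y, s (N x) y = s x (N y))
    (hP : ∀ x, P (P x) = P x) (hNP : ∀ x, N (P x) = N x - P (N x))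
    (hPs : ∀ x y, s x (P y) = s (P x) y) {m d z : F}
    {b : LinearMap.BilinForm F ((W × W) × (W × W))}
    (hb : ∀ v w, b v w = hyperbolicForm s v.1 w.1 + hyperbolicForm s v.2 w.2)
    {u : Module.End F ((W × W) × (W × W))}
    (hu : ∀ v, u v = ((N v.1.1 + z • v.1.1, N v.1.2 + z • v.1.2),
      (N v.2.1 + z • v.2.1, N v.2.2 + z • v.2.2))) :
    IsQuadraticDifference (m + 2 * z) (z ^ 2 + m * z + d) m d b u := by
  set l := m + 2 * z with hl
  set c := z ^ 2 + m * z + d with hc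
  have hPN : ∀ x, P (N x) = N x - N (P x) := fun x => by rw [hNP]; abel
  refine ⟨{ toFun := fun w =>
              ((l • P w.1.1 + c • (2 • P w.2.1 - w.2.1) + N (P w.1.1),
                w.2.2 - 2 • P w.2.2 + l • P w.1.2 + P (N w.1.2)),
               (w.1.1 - 2 • P w.1.1 + l • (w.2.1 - P w.2.1) + N (P w.2.1),
                c • (2 • P w.1.2 - w.1.2) + l • (w.2.2 - P w.2.2) + P (N w.2.2)))
            map_add' := fun v w => by
              ext <;> simp only [Prod.fst_add, Prod.snd_add, map_add] <;> module
            map_smul' := fun r w => by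
              ext <;> simp only [Prod.smul_fst, Prod.smul_snd, map_smul, RingHom.id_apply] <;>
                module }, ?_, ?_, ?_⟩
  · rintro ⟨⟨x, y⟩, x', y'⟩
    simp only [LinearMap.coe_mk, AddHom.coe_mk, hb, hyperbolicForm_apply, map_add, map_sub,
      map_smul, map_nsmul, smul_eq_mul, nsmul_eq_mul]
    rw [hPs x y', hPs x y, hPs x (N y), hPs x' y', hPs x' y, hPs x' (N y'), ← hN (P x), ← hN (P x')]
    simp only [hs y, hs y']
    ring
  · rintro ⟨⟨x, y⟩, x', y'⟩
    ext <;> simp only [LinearMap.coe_mk, AddHom.coe_mk, map_add, map_sub, map_smul, map_nsmul, hP,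
      hPN, Prod.fst_sub, Prod.snd_sub, Prod.smul_fst, Prod.smul_snd, map_zero, sub_self] <;> module
  · rintro ⟨⟨x, y⟩, x', y'⟩
    ext <;> simp only [LinearMap.sub_apply, hu,
      LinearMap.coe_mk, AddHom.coe_mk, map_add, map_sub, map_smul,
      map_nsmul, hP, hPN, Prod.fst_sub, Prod.snd_sub, Prod.smul_fst, Prod.smul_snd, map_zero,
      sub_self, hl, hc] <;> module

/-- The form on `(W × W) × (W × W)` making, for `S` self-adjoint for the symmetric form `s`, the
operator `quadraticEnd S e` alternating. It is the double of `W ⊕ t W`, where `t² = e t + S`, for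
the symmetric form sending `(x + t x', y + t y')` to the `t`-coordinate of their product, expanded
by means of `s`: `s x y' + s x' y + e s x' y'`. -/
noncomputable def quadraticForm (s : LinearMap.BilinForm F W) (e : F) :
    LinearMap.BilinForm F ((W × W) × (W × W)) :=
  LinearMap.mk₂ F (fun v w => s v.1.1 w.2.2 + s v.1.2 w.2.1 + e * s v.1.2 w.2.2
      - (s v.2.2 w.1.1 + s v.2.1 w.1.2 + e * s v.2.2 w.1.2))
    (fun _ _ _ => by simp; ring) (fun _ _ _ => by simp; ring) (fun _ _ _ => by simp; ring)
    (fun _ _ _ => by simp; ring)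

@[simp] theorem quadraticForm_apply (s : LinearMap.BilinForm F W) (e : F)
    (v w : (W × W) × (W × W)) : quadraticForm s e v w =
      s v.1.1 w.2.2 + s v.1.2 w.2.1 + e * s v.1.2 w.2.2
      - (s v.2.2 w.1.1 + s v.2.1 w.1.2 + e * s v.2.2 w.1.2) := rfl

/-- Multiplication by `t` on two copies of `W ⊕ t W`, where `t² = e t + S`. -/
def quadraticEnd (S : Module.End F W) (e : F) : Module.End F ((W × W) × (W × W)) where
  toFun w := ((S w.1.2, w.1.1 + e • w.1.2), (S w.2.2, w.2.1 + e • w.2.2))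
  map_add' v w := by ext <;> simp only [Prod.fst_add, Prod.snd_add, map_add] <;> module
  map_smul' r w := by
    ext <;> simp only [Prod.smul_fst, Prod.smul_snd, map_smul, RingHom.id_apply] <;> module

theorem quadraticEnd_apply (S : Module.End F W) (e : F) (w : (W × W) × (W × W)) :
    quadraticEnd S e w = ((S w.1.2, w.1.1 + e • w.1.2), (S w.2.2, w.2.1 + e • w.2.2)) := rfl

/-- For arbitrary quadratic polynomials `X² - l X + c` and `X² - m X + d`, the double of
multiplication by `t` on `W ⊕ t W`, where `t² = (l - m) t + S`, is a difference. The algebra over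
`F[S]` generated by `a` and `t` with `a² = l a - c`, `t² = (l - m) t + S` and `(a - t)² = m (a - t) - d` is
free with basis `1, t, - a, - t a`, and the formula below is left multiplication by `a` in this
basis. The form comes from the coordinate on `- t a` of `τ x * y`, with `τ` the anti-automorphism
fixing `a` and `t`. -/
theorem isQuadraticDifference_quadraticForm {s : LinearMap.BilinForm F W}
    (hs : ∀ x y, s x y = s y x) {S : Module.End F W} (hS : ∀ x y, s (S x) y = s x (S y))
    (l c m d : F) :
    IsQuadraticDifference l c m d (quadraticForm s (l - m)) (quadraticEnd S (l - m)) := by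
  refine ⟨{ toFun := fun w =>
              ((S w.1.2 + (d - c) • w.1.2 + c • w.2.1 + ((l - m) * c) • w.2.2,
                l • w.1.2 - c • w.2.2),
               (- w.1.1 - (l - m) • w.1.2 + l • w.2.1 + ((l - m) * l + d - c) • w.2.2 + S w.2.2,
                w.1.2))
            map_add' := fun v w => by
              ext <;> simp only [Prod.fst_add, Prod.snd_add, map_add] <;> module
            map_smul' := fun r w => by
              ext <;> simp only [Prod.smul_fst, Prod.smul_snd, map_smul, RingHom.id_apply] <;>
                module }, ?_, ?_, ?_⟩
  · rintro ⟨⟨x, y⟩, x', y'⟩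
    simp only [LinearMap.coe_mk, AddHom.coe_mk, quadraticForm_apply, map_add, map_sub,
      map_smul, smul_eq_mul, map_neg]
    rw [hs y' (S y), hS, hs x' y, hs y' y, hs y x, hs y' x']
    ring
  · rintro ⟨⟨x, y⟩, x', y'⟩
    ext <;> simp only [LinearMap.coe_mk, AddHom.coe_mk, map_sub, map_smul,
      Prod.fst_sub, Prod.snd_sub, Prod.smul_fst, Prod.smul_snd] <;> module
  · rintro ⟨⟨x, y⟩, x', y'⟩
    ext <;> simp only [LinearMap.sub_apply, quadraticEnd_apply,
      LinearMap.coe_mk, AddHom.coe_mk, map_add, map_sub, map_smul,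
      Prod.fst_sub, Prod.snd_sub, Prod.smul_fst, Prod.smul_snd] <;> module

end Models

/-! ### The nilpotent Jordan cell and its symmetric form -/

section Shift

variable {F : Type*} [Field F] {n : ℕ}

/-- The nilpotent Jordan cell of size `n`: it sends the `i`-th basis vector of `Fin n → F` to the
`i + 1`-st one, and the last one to `0`. -/
def shift (F : Type*) [Field F] (n : ℕ) : Module.End F (Fin n → F) where
  toFun w i := if (i : ℕ) = 0 then 0 else w ⟨i - 1, by omega⟩
  map_add' v w := by ext i; by_cases h : (i : ℕ) = 0 <;> simp [h]
  map_smul' r w := by ext i; by_cases h : (i : ℕ) = 0 <;> simp [h]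

theorem shift_apply (w : Fin n → F) (i : Fin n) :
    shift F n w i = if (i : ℕ) = 0 then 0 else w ⟨i - 1, by omega⟩ := rfl

/-- The projector of `Fin n → F` on the basis vectors of odd index. -/
def oddProj (F : Type*) [Field F] (n : ℕ) : Module.End F (Fin n → F) where
  toFun w i := if Odd (i : ℕ) then w i else 0
  map_add' v w := by ext i; by_cases h : Odd (i : ℕ) <;> simp [h]
  map_smul' r w := by ext i; by_cases h : Odd (i : ℕ) <;> simp [h]

theorem oddProj_apply (w : Fin n → F) (i : Fin n) :
    oddProj F n w i = if Odd (i : ℕ) then w i else 0 := rfl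

/-- The symmetric form `∑ wᵢ w'ₙ₋₁₋ᵢ`, for which the nilpotent Jordan cell is self-adjoint. -/
noncomputable def revForm (F : Type*) [Field F] (n : ℕ) : LinearMap.BilinForm F (Fin n → F) :=
  LinearMap.mk₂ F (fun v w => ∑ i, v i * w i.rev)
    (fun _ _ _ => by simp [add_mul, Finset.sum_add_distrib])
    (fun _ _ _ => by simp [Finset.mul_sum, mul_assoc])
    (fun _ _ _ => by simp [mul_add, Finset.sum_add_distrib])
    (fun _ _ _ => by simp [Finset.mul_sum, mul_left_comm])

theorem revForm_apply (v w : Fin n → F) : revForm F n v w = ∑ i, v i * w i.rev := rfl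

theorem revForm_comm (v w : Fin n → F) : revForm F n v w = revForm F n w v := by
  rw [revForm_apply, revForm_apply, ← Equiv.sum_comp Fin.revPerm]
  simp [mul_comm]

@[simp] theorem revForm_single_left (i : Fin n) (w : Fin n → F) :
    revForm F n (Pi.single i 1) w = w i.rev := by
  simp [revForm_apply, Pi.single_apply]

theorem revForm_separating {v : Fin n → F} (h : ∀ w, revForm F n v w = 0) : v = 0 := by
  ext i
  have := h (Pi.single i.rev 1)
  rwa [revForm_comm, revForm_single_left, Fin.rev_rev] at this

theorem shift_single (i : Fin n) : shift F n (Pi.single i 1) =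
    if h : (i : ℕ) + 1 < n then Pi.single ⟨i + 1, h⟩ 1 else 0 := by
  ext j
  rw [shift_apply]
  split_ifs with h1 h2 h2
  · rw [Pi.single_apply, if_neg]; simp [Fin.ext_iff]; omega
  · rfl
  · simp only [Pi.single_apply, Fin.ext_iff]
    congr 1
    simp only [eq_iff_iff]; omega
  · rw [Pi.single_apply, if_neg]
    · rfl
    · simp only [Fin.ext_iff]; omega

theorem revForm_shift (v w : Fin n → F) :
    revForm F n (shift F n v) w = revForm F n v (shift F n w) := by
  have : (revForm F n).compl₁₂ (shift F n) LinearMap.id =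
      (revForm F n).compl₁₂ LinearMap.id (shift F n) := by
    refine LinearMap.BilinForm.ext_basis (Pi.basisFun F (Fin n)) fun i j => ?_
    simp only [LinearMap.compl₁₂_apply, Pi.basisFun_apply, LinearMap.id_apply, revForm_single_left,
      shift_single]
    split_ifs with h1 h2 h2 <;>
      simp only [revForm_single_left, Pi.single_apply, Fin.ext_iff, Fin.val_rev, map_zero,
        LinearMap.zero_apply, Pi.zero_apply]
    · congr 1; simp only [eq_iff_iff]; omega
    · rw [if_neg]; omega
    · rw [if_neg]; omega
  exact LinearMap.congr_fun₂ this v w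

theorem oddProj_oddProj (w : Fin n → F) : oddProj F n (oddProj F n w) = oddProj F n w := by
  ext i; simp only [oddProj_apply]; split_ifs <;> rfl

theorem shift_oddProj (w : Fin n → F) :
    shift F n (oddProj F n w) = shift F n w - oddProj F n (shift F n w) := by
  ext i
  simp only [oddProj_apply, shift_apply, Pi.sub_apply, Nat.odd_iff]
  split_ifs <;> first | omega | simp

theorem revForm_oddProj_of_even (hn : Even n) (v w : Fin n → F) :
    revForm F n v (oddProj F n w) = revForm F n v w - revForm F n (oddProj F n v) w := by
  rw [Nat.even_iff] at hn
  simp only [revForm_apply, ← Finset.sum_sub_distrib]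
  refine Finset.sum_congr rfl fun i _ => ?_
  have := i.2
  simp only [oddProj_apply, Fin.val_rev, Nat.odd_iff]
  split_ifs <;> first | omega | simp

theorem revForm_oddProj_of_odd (hn : Odd n) (v w : Fin n → F) :
    revForm F n v (oddProj F n w) = revForm F n (oddProj F n v) w := by
  rw [Nat.odd_iff] at hn
  simp only [revForm_apply]
  refine Finset.sum_congr rfl fun i _ => ?_
  have := i.2
  simp only [oddProj_apply, Fin.val_rev, Nat.odd_iff]
  split_ifs <;> first | omega | simp

theorem shift_pow_apply (k : ℕ) (w : Fin n → F) (i : Fin n) :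
    (shift F n ^ k) w i = if h : k ≤ (i : ℕ) then w ⟨i - k, by omega⟩ else 0 := by
  induction k generalizing i with
  | zero => simp
  | succ k ih =>
    rw [pow_succ', Module.End.mul_apply, shift_apply]
    simp only [ih]
    split_ifs <;> first | rfl | omega | (congr 2; omega)

theorem shift_pow_eq_zero {k : ℕ} (hk : n ≤ k) : shift F n ^ k = 0 := by
  ext1 i
  ext j
  simp only [LinearMap.comp_apply, shift_pow_apply]
  rw [dif_neg (by omega)]; rfl

theorem finrank_range_shift_pow (hn : 1 ≤ n) :
    Module.finrank F (LinearMap.range (shift F n ^ (n - 1))) = 1 := by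
  have : LinearMap.range (shift F n ^ (n - 1)) =
      Submodule.span F {(Pi.single ⟨n - 1, by omega⟩ 1 : Fin n → F)} := by
    have key : ∀ w : Fin n → F, (shift F n ^ (n - 1)) w =
        w ⟨0, by omega⟩ • Pi.single ⟨n - 1, by omega⟩ 1 := by
      intro w
      ext i
      simp only [shift_pow_apply, Pi.smul_apply, Pi.single_apply, Fin.ext_iff, smul_eq_mul]
      split_ifs with h1 h2 h2
      · rw [mul_one]; congr 2; omega
      · omega
      · omega
      · simp
    apply le_antisymm
    · rintro _ ⟨w, rfl⟩
      rw [key]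
      exact Submodule.smul_mem _ _ (Submodule.mem_span_singleton_self _)
    · rw [Submodule.span_singleton_le_iff_mem]
      exact ⟨Pi.single ⟨0, by omega⟩ 1, by rw [key]; simp⟩
  rw [this, finrank_span_singleton]
  simp

theorem finrank_submodule_prod {X V' : Type*} [AddCommGroup X] [Module F X]
    [FiniteDimensional F X] [AddCommGroup V'] [Module F V'] [FiniteDimensional F V']
    (p : Submodule F X) (q : Submodule F V') :
    Module.finrank F (p.prod q) = Module.finrank F p + Module.finrank F q := by
  have h : LinearMap.range (p.subtype.prodMap q.subtype) = p.prod q := by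
    rw [LinearMap.range_prodMap, Submodule.range_subtype, Submodule.range_subtype]
  rw [← h, LinearMap.finrank_range_of_inj, Module.finrank_prod]
  exact Function.Injective.prodMap p.injective_subtype q.injective_subtype

/-- The number of Jordan cells is additive on direct sums. -/
theorem jordanCells_of_equiv_prod {X V V' : Type*} [AddCommGroup X] [Module F X]
    [FiniteDimensional F X] [AddCommGroup V] [Module F V] [FiniteDimensional F V]
    [AddCommGroup V'] [Module F V'] [FiniteDimensional F V'] {uX : Module.End F X}
    {u' : Module.End F V'} {u : Module.End F V} (e : (X × V') ≃ₗ[F] V)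
    (hu : ∀ v, u (e v) = e (uX v.1, u' v.2)) (z : F) (k : ℕ) (hk : 1 ≤ k) :
    jordanCells u z k = jordanCells uX z k + jordanCells u' z k := by
  have hpow : ∀ (k : ℕ) v, ((u - algebraMap F (Module.End F V) z) ^ k) (e v) =
      e (((uX - algebraMap F (Module.End F X) z) ^ k) v.1,
        ((u' - algebraMap F (Module.End F V') z) ^ k) v.2) := by
    intro k
    induction k with
    | zero => simp
    | succ k ih =>
      intro v
      simp only [pow_succ, Module.End.mul_apply, ← ih (_, _)]
      congr 1
      simp only [LinearMap.sub_apply, hu, Module.algebraMap_end_apply, ← map_smul e, ← map_sub e]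
      rfl
  have hk' : ∀ k : ℕ, Module.finrank F (LinearMap.ker ((u - algebraMap F (Module.End F V) z) ^ k)) =
      Module.finrank F (LinearMap.ker ((uX - algebraMap F (Module.End F X) z) ^ k)) +
      Module.finrank F (LinearMap.ker ((u' - algebraMap F (Module.End F V') z) ^ k)) := by
    intro k
    have : LinearMap.ker ((u - algebraMap F (Module.End F V) z) ^ k) = Submodule.map e.toLinearMap
        ((LinearMap.ker ((uX - algebraMap F (Module.End F X) z) ^ k)).prod
          (LinearMap.ker ((u' - algebraMap F (Module.End F V') z) ^ k))) := by
      ext v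
      obtain ⟨v, rfl⟩ := e.surjective v
      rw [LinearMap.mem_ker, hpow, LinearEquiv.map_eq_zero_iff, Submodule.mem_map_equiv,
        e.symm_apply_apply, Submodule.mem_prod, Prod.mk_eq_zero]
      rfl
    rw [this, ← (Submodule.equivMapOfInjective e.toLinearMap e.injective _).finrank_eq,
      finrank_submodule_prod]
  have h1 := jordanCells_add u z k hk
  have h2 := jordanCells_add uX z k hk
  have h3 := jordanCells_add u' z k hk
  rw [hk', hk', hk'] at h1
  omega

/-- The double of the Jordan cell of size `n` has two Jordan cells of size `n`. -/
theorem jordanCells_prodMap_shift (hn : 1 ≤ n) (z : F) :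
    jordanCells ((shift F n + algebraMap F (Module.End F (Fin n → F)) z).prodMap
      (shift F n + algebraMap F (Module.End F (Fin n → F)) z)) z n = 2 := by
  have h1 : jordanCells (shift F n + algebraMap F (Module.End F (Fin n → F)) z) z n = 1 := by
    have h := jordanCells_add_finrank_range
      (shift F n + algebraMap F (Module.End F (Fin n → F)) z) z n hn
    rw [add_sub_cancel_right, shift_pow_eq_zero le_rfl, shift_pow_eq_zero (Nat.le_succ n),
      finrank_range_shift_pow hn, LinearMap.range_zero, finrank_bot] at h
    omega
  rw [jordanCells_of_equiv_prod (uX := shift F n + algebraMap F _ z)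
    (u' := shift F n + algebraMap F _ z) (LinearEquiv.refl F _) (fun v => rfl) z n hn, h1]

variable {V : Type*} [AddCommGroup V] [Module F V]

/-- The map sending the `i`-th basis vector of `Fin n → F` to `N ^ i x`. -/
noncomputable def orbitMap (n : ℕ) (N : Module.End F V) (x : V) : (Fin n → F) →ₗ[F] V :=
  Fintype.linearCombination F (fun i : Fin n => (N ^ (i : ℕ)) x)

theorem orbitMap_single (N : Module.End F V) (x : V) (i : Fin n) :
    orbitMap n N x (Pi.single i 1) = (N ^ (i : ℕ)) x := by
  rw [orbitMap, Fintype.linearCombination_apply_single, one_smul]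

theorem orbitMap_shift {N : Module.End F V} {x : V} (hx : (N ^ n) x = 0) (w : Fin n → F) :
    orbitMap n N x (shift F n w) = N (orbitMap n N x w) := by
  have : orbitMap n N x ∘ₗ shift F n = N ∘ₗ orbitMap n N x := by
    refine (Pi.basisFun F (Fin n)).ext fun i => ?_
    simp only [LinearMap.comp_apply, Pi.basisFun_apply, shift_single, orbitMap_single,
      ← Module.End.mul_apply N, ← pow_succ']
    split_ifs with h
    · rw [orbitMap_single]
    · rw [map_zero, show (i : ℕ) + 1 = n by omega, hx]
  exact LinearMap.congr_fun this w

theorem apply_orbitMap_orbitMap {b : LinearMap.BilinForm F V} {N f : Module.End F V} {x y : V}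
    {t : F} (h : ∀ i j : Fin n, b (f ((N ^ (i : ℕ)) x)) ((N ^ (j : ℕ)) y) =
      if (i : ℕ) + j + 1 = n then t else 0) (v w : Fin n → F) :
    b (f (orbitMap n N x v)) (orbitMap n N y w) = t * revForm F n v w := by
  have : b.compl₁₂ (f ∘ₗ orbitMap n N x) (orbitMap n N y) = t • revForm F n := by
    refine LinearMap.BilinForm.ext_basis (Pi.basisFun F (Fin n)) fun i j => ?_
    simp only [LinearMap.compl₁₂_apply, Pi.basisFun_apply, LinearMap.comp_apply, orbitMap_single, h,
      LinearMap.smul_apply, revForm_single_left, Pi.single_apply, smul_eq_mul, mul_ite, mul_one,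
      mul_zero, Fin.ext_iff, Fin.val_rev]
    congr 1; simp only [eq_iff_iff]; omega
  exact LinearMap.congr_fun₂ this v w

end Shift

/-! ### Splitting off cyclic blocks -/

section Blocks

variable {F : Type*} [Field F] {V : Type*} [AddCommGroup V] [Module F V]

theorem IsSymplecticPair.apply_left {b : LinearMap.BilinForm F V} {u : Module.End F V}
    (h : IsSymplecticPair b u) (x y : V) : b (u x) y = b x (u y) :=
  h.isAlt.apply_left_eq_apply_right h.alternating x y

theorem IsSymplecticPair.apply_aeval_left {b : LinearMap.BilinForm F V} {u : Module.End F V}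
    (h : IsSymplecticPair b u) (f : F[X]) (x y : V) : b (aeval u f x) y = b x (aeval u f y) :=
  _root_.apply_aeval_left h.apply_left f x y

/-- Cyclic subspaces are totally isotropic. -/
theorem IsSymplecticPair.apply_aeval_aeval {b : LinearMap.BilinForm F V} {u : Module.End F V}
    (h : IsSymplecticPair b u) (f g : F[X]) (x : V) : b (aeval u f x) (aeval u g x) = 0 := by
  rw [h.apply_aeval_left, ← Module.End.mul_apply, ← map_mul]
  exact h.isAlt.apply_aeval_self h.alternating _ _

/-- An isometric embedding of a nondegenerate pair splits off as an orthogonal summand. -/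
theorem IsSymplecticPair.exists_orthogonal_complement [FiniteDimensional F V]
    {b : LinearMap.BilinForm F V} {u : Module.End F V} (h : IsSymplecticPair b u)
    {X : Type*} [AddCommGroup X] [Module F X] {bX : LinearMap.BilinForm F X} {uX : Module.End F X}
    (hsep : ∀ v, (∀ w, bX v w = 0) → v = 0) (Ψ : X →ₗ[F] V)
    (hΨ : ∀ v w, b (Ψ v) (Ψ w) = bX v w) (hu : ∀ v, u (Ψ v) = Ψ (uX v)) :
    ∃ (V' : Submodule F V) (u' : Module.End F V') (e : (X × V') ≃ₗ[F] V),
      IsSymplecticPair (b.restrict V') u' ∧ (∀ y, (u' y : V) = u y) ∧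
      (∀ v w, b (e v) (e w) = bX v.1 w.1 + b.restrict V' v.2 w.2) ∧
      (∀ v, u (e v) = e (uX v.1, u' v.2)) := by
  set V' := b.orthogonal (LinearMap.range Ψ) with hV'
  have hmem : ∀ y, y ∈ V' ↔ ∀ v, b (Ψ v) y = 0 := by
    intro y
    simp [hV', LinearMap.BilinForm.mem_orthogonal_iff]
  have hst : ∀ y ∈ V', u y ∈ V' := by
    intro y hy
    rw [hmem] at hy ⊢
    intro v
    rw [← h.apply_left, hu, hy]
  have hnd : (b.restrict (LinearMap.range Ψ)).Nondegenerate := by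
    have hr : (b.restrict (LinearMap.range Ψ)).IsRefl := fun x y => h.isAlt.isRefl x.1 y.1
    refine hr.nondegenerate_iff_separatingLeft.2 ?_
    rintro ⟨_, v, rfl⟩ hv
    have : v = 0 := hsep v fun w => by rw [← hΨ]; exact hv ⟨_, w, rfl⟩
    simp [this]
  have hcompl : IsCompl (LinearMap.range Ψ) V' :=
    LinearMap.BilinForm.isCompl_orthogonal_of_restrict_nondegenerate h.isAlt.isRefl hnd
  have hinj : Function.Injective (LinearMap.coprod Ψ V'.subtype) := by
    rw [injective_iff_map_eq_zero]
    rintro ⟨v, y⟩ hvy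
    simp only [LinearMap.coprod_apply, Submodule.subtype_apply] at hvy
    have hy : (y : V) = Ψ (-v) := by rw [map_neg]; exact eq_neg_of_add_eq_zero_right hvy
    have hv : v = 0 := hsep v fun w => by
      have := (hmem _).1 y.2 w
      rw [hy, map_neg, map_neg, neg_eq_zero] at this
      rw [← hΨ]; exact h.isAlt.isRefl.eq_zero this
    rw [hv, neg_zero, map_zero] at hy
    rw [hv, Prod.mk_eq_zero]
    exact ⟨rfl, Subtype.ext hy⟩
  have hsurj : Function.Surjective (LinearMap.coprod Ψ V'.subtype) := by
    rw [← LinearMap.range_eq_top, LinearMap.range_coprod, Submodule.range_subtype]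
    exact hcompl.sup_eq_top
  obtain ⟨e, he⟩ : ∃ e : (X × V') ≃ₗ[F] V, ∀ v y, e (v, y) = Ψ v + y :=
    ⟨LinearEquiv.ofBijective _ ⟨hinj, hsurj⟩, fun _ _ => rfl⟩
  refine ⟨V', u.restrict hst, e, ⟨?_, ?_, ?_⟩, ?_, ?_, ?_⟩
  · exact fun y => h.isAlt y
  · have hr : (b.restrict V').IsRefl := fun x y => h.isAlt.isRefl x.1 y.1
    refine hr.nondegenerate_iff_separatingLeft.2 fun y hy => Subtype.ext (h.nondegenerate.1 _ ?_)
    intro w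
    obtain ⟨⟨v, y'⟩, rfl⟩ := hsurj w
    simp only [LinearMap.coprod_apply, Submodule.subtype_apply, map_add]
    rw [h.isAlt.isRefl.eq_zero ((hmem _).1 y.2 v), zero_add]
    exact hy y'
  · exact fun y => h.alternating y
  · exact fun y => rfl
  · rintro ⟨v, y⟩ ⟨w, y'⟩
    simp only [he, map_add, LinearMap.add_apply, hΨ, (hmem _).1 y'.2 v,
      h.isAlt.isRefl.eq_zero ((hmem _).1 y.2 w), add_zero, zero_add]
    rfl
  · rintro ⟨v, y⟩
    simp only [he, map_add, hu]
    rfl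

/-- If `r` is irreducible and `x` is killed by `r ^ n` but not by `r ^ (n - 1)`, then the
annihilator of `x` is generated by `r ^ n`. -/
theorem pow_dvd_of_aeval_apply_eq_zero {u : Module.End F V} {r : F[X]} (hr : Irreducible r) {n : ℕ}
    (hn : 1 ≤ n) {x : V} (hx : aeval u (r ^ n) x = 0) (hx' : aeval u (r ^ (n - 1)) x ≠ 0)
    {f : F[X]} (hf : aeval u f x = 0) : r ^ n ∣ f := by
  classical
  have hg : aeval u (EuclideanDomain.gcd f (r ^ n)) x = 0 := by
    rw [EuclideanDomain.gcd_eq_gcd_ab, mul_comm f, mul_comm (r ^ n)]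
    simp only [map_add, map_mul, LinearMap.add_apply, Module.End.mul_apply, hf, hx, map_zero,
      add_zero]
  obtain ⟨k, hk, hass⟩ := (dvd_prime_pow hr.prime n).1 (EuclideanDomain.gcd_dvd_right f (r ^ n))
  rcases hk.lt_or_eq with hlt | rfl
  · exfalso
    apply hx'
    obtain ⟨t, ht⟩ := hass.dvd.trans (pow_dvd_pow r (Nat.le_sub_one_of_lt hlt))
    rw [ht, mul_comm, map_mul, Module.End.mul_apply, hg, map_zero]
  · exact hass.symm.dvd.trans (EuclideanDomain.gcd_dvd_left _ _)

/-- Let `M` generate the annihilator of `x`, and let `M g` kill the whole space, with `M` prime to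
`g`. Every linear form on `F[X] / (M)` is of the form `f ↦ b (f (u) x, y)` with `M (u) y = 0`. -/
theorem IsSymplecticPair.exists_dual_vector [FiniteDimensional F V]
    {b : LinearMap.BilinForm F V} {u : Module.End F V} (h : IsSymplecticPair b u) {M g : F[X]}
    (hMg : IsCoprime M g) (hu : aeval u (M * g) = 0) {x : V}
    (hann : ∀ f, aeval u f x = 0 → M ∣ f) {ℓ : F[X] →ₗ[F] F} (hℓ : ∀ f, M ∣ f → ℓ f = 0) :
    ∃ y, aeval u M y = 0 ∧ ∀ f, b (aeval u f x) y = ℓ f := by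
  set A : F[X] →ₗ[F] V := (LinearMap.applyₗ x).comp (aeval u).toLinearMap with hA
  have hAf : ∀ f, A f = aeval u f x := fun f => rfl
  have hker : ℓ ∈ LinearMap.range A.dualMap := by
    rw [LinearMap.range_dualMap_eq_dualAnnihilator_ker, Submodule.mem_dualAnnihilator]
    exact fun f hf => hℓ f (hann f hf)
  obtain ⟨θ, hθ⟩ := hker
  have hθ' : ∀ f, θ (aeval u f x) = ℓ f := fun f => by rw [← hθ]; rfl
  obtain ⟨y, hy⟩ := (b.toDual h.nondegenerate).surjective θ
  have hy' : ∀ v, b v (-y) = θ v := fun v => by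
    rw [map_neg, h.isAlt.neg_eq, ← hy, LinearMap.BilinForm.toDual_def]
  obtain ⟨s, t, hst⟩ := hMg
  -- the projection of `- y` to the kernel of `M (u)`
  refine ⟨aeval u (t * g) (-y), ?_, fun f => ?_⟩
  · rw [← Module.End.mul_apply, ← map_mul, mul_left_comm, map_mul, hu, mul_zero,
      LinearMap.zero_apply]
  · rw [← h.apply_aeval_left, hy', ← Module.End.mul_apply, ← map_mul, hθ']
    have : t * g * f = f - M * (s * f) := by linear_combination f * hst
    rw [this, map_sub, hℓ _ (dvd_mul_right _ _), sub_zero]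

/-- The linear form on `F[X] / (M)` taking the top coefficient of the representative of degree
less than `deg M`. -/
noncomputable def topCoeff (M : F[X]) : F[X] →ₗ[F] F :=
  (lcoeff F (M.natDegree - 1)).comp (M.modByMonicHom)

theorem topCoeff_of_dvd {M f : F[X]} (hM : M.Monic) (h : M ∣ f) : topCoeff M f = 0 := by
  have : f %ₘ M = 0 := (modByMonic_eq_zero_iff_dvd hM).2 h
  simp [topCoeff, modByMonicHom_apply, this]

theorem topCoeff_of_natDegree_lt {M f : F[X]} (hM : M.Monic) (h : f.natDegree < M.natDegree) :
    topCoeff M f = f.coeff (M.natDegree - 1) := by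
  have : f %ₘ M = f := (modByMonic_eq_self_iff hM).2 (degree_lt_degree h)
  simp [topCoeff, modByMonicHom_apply, this]

theorem exists_orbitMap_eq_aeval (u : Module.End F V) (r : F[X]) (x : V) {n : ℕ} (w : Fin n → F) :
    ∃ f : F[X], orbitMap n (aeval u r) x w = aeval u f x := by
  refine ⟨∑ i, w i • r ^ (i : ℕ), ?_⟩
  simp [orbitMap, Fintype.linearCombination_apply, LinearMap.sum_apply]

/-- A vector of order `(X - z) ^ n` generates, together with a dual vector, a copy of the double of
the Jordan cell of size `n`. -/
theorem IsSymplecticPair.exists_hyperbolic_embedding [FiniteDimensional F V]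
    {b : LinearMap.BilinForm F V} {u : Module.End F V} (h : IsSymplecticPair b u) {g : F[X]} {z : F}
    {n : ℕ} (hn : 1 ≤ n) (hg : IsCoprime ((X - C z) ^ n) g) (hu : aeval u ((X - C z) ^ n * g) = 0)
    {x : V} (hx : aeval u ((X - C z) ^ n) x = 0) (hx' : aeval u ((X - C z) ^ (n - 1)) x ≠ 0) :
    ∃ Ψ : (Fin n → F) × (Fin n → F) →ₗ[F] V,
      (∀ v w, b (Ψ v) (Ψ w) = hyperbolicForm (revForm F n) v w) ∧
      ∀ v, u (Ψ v) = Ψ (((shift F n + algebraMap F (Module.End F (Fin n → F)) z).prodMap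
        (shift F n + algebraMap F (Module.End F (Fin n → F)) z)) v) := by
  have hM : ((X - C z) ^ n).Monic := (monic_X_sub_C z).pow n
  obtain ⟨y, hy, hxy⟩ := h.exists_dual_vector hg hu
    (fun f => pow_dvd_of_aeval_apply_eq_zero (irreducible_X_sub_C z) hn hx hx')
    (ℓ := topCoeff ((X - C z) ^ n)) (fun f => topCoeff_of_dvd hM)
  have hdeg : ∀ i, ((X - C z) ^ i).natDegree = i := by simp
  have htop : ∀ i, topCoeff ((X - C z) ^ n) ((X - C z) ^ i) = if i + 1 = n then 1 else 0 := by
    intro i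
    rcases lt_or_ge i n with hi | hi
    · rw [topCoeff_of_natDegree_lt hM (by rwa [hdeg, hdeg]), hdeg]
      split_ifs with h1
      · rw [show n - 1 = ((X - C z) ^ i).natDegree by rw [hdeg]; omega]
        exact (monic_X_sub_C z).pow i
      · exact coeff_eq_zero_of_natDegree_lt (by rw [hdeg]; omega)
    · rw [topCoeff_of_dvd hM (pow_dvd_pow _ hi), if_neg (by omega)]
  set N := aeval u (X - C z) with hN
  have hNu : ∀ v, u v = N v + z • v := fun v => by simp [hN, Module.algebraMap_end_apply]
  have hNx : (N ^ n) x = 0 := by rw [hN, ← map_pow]; exact hx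
  have hNy : (N ^ n) y = 0 := by rw [hN, ← map_pow]; exact hy
  have hiso : ∀ v w, b (orbitMap n N x v) (orbitMap n N y w) = revForm F n v w := by
    intro v w
    rw [← one_mul (revForm F n v w)]
    refine apply_orbitMap_orbitMap (f := LinearMap.id) (fun i j => ?_) v w
    rw [LinearMap.id_apply, hN, ← map_pow, ← map_pow, ← h.apply_aeval_left, ← Module.End.mul_apply,
      ← map_mul, ← pow_add, hxy, htop, add_comm (j : ℕ)]
  have hzero : ∀ x v w, b (orbitMap n N x v) (orbitMap n N x w) = 0 := by
    intro x v w
    obtain ⟨f, hf⟩ := exists_orbitMap_eq_aeval u (X - C z) x v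
    obtain ⟨g, hg⟩ := exists_orbitMap_eq_aeval u (X - C z) x w
    rw [hf, hg, h.apply_aeval_aeval]
  refine ⟨(orbitMap n N x).coprod (orbitMap n N y), ?_, ?_⟩
  · rintro ⟨v, v'⟩ ⟨w, w'⟩
    simp only [LinearMap.coprod_apply, map_add, LinearMap.add_apply, hzero, hiso, zero_add,
      add_zero, hyperbolicForm_apply]
    rw [← h.isAlt.neg_eq, hiso, revForm_comm]; ring
  · rintro ⟨v, v'⟩
    simp only [LinearMap.coprod_apply, map_add, LinearMap.prodMap_apply, LinearMap.add_apply,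
      Module.algebraMap_end_apply, orbitMap_shift hNx, orbitMap_shift hNy, map_smul, hNu]
    module

/-- A vector of order `(X² - e X + t) ^ n`, with `X² - e X + t` irreducible, generates, together
with a dual vector, a copy of the double of multiplication by `X` on
`F[X] / ((X² - e X + t) ^ n)`. -/
theorem IsSymplecticPair.exists_quadratic_embedding [FiniteDimensional F V]
    {b : LinearMap.BilinForm F V} {u : Module.End F V} (h : IsSymplecticPair b u) {r g : F[X]}
    (hirr : Irreducible r) {e t : F} (hr : r = X ^ 2 - C e * X + C t)
    {n : ℕ} (hn : 1 ≤ n) (hg : IsCoprime (r ^ n) g) (hu : aeval u (r ^ n * g) = 0)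
    {x : V} (hx : aeval u (r ^ n) x = 0) (hx' : aeval u (r ^ (n - 1)) x ≠ 0) :
    ∃ Ψ : ((Fin n → F) × (Fin n → F)) × ((Fin n → F) × (Fin n → F)) →ₗ[F] V,
      (∀ v w, b (Ψ v) (Ψ w) = quadraticForm (revForm F n) e v w) ∧
      ∀ v, u (Ψ v) =
        Ψ (quadraticEnd (shift F n - algebraMap F (Module.End F (Fin n → F)) t) e v) := by
  have hrdeg : r.natDegree = 2 := by rw [hr]; compute_degree!
  have hrmon : r.Monic := by rw [hr]; monicity!
  have hM : (r ^ n).Monic := hrmon.pow n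
  obtain ⟨y, hy, hxy⟩ := h.exists_dual_vector hg hu
    (fun f => pow_dvd_of_aeval_apply_eq_zero hirr hn hx hx')
    (ℓ := topCoeff (r ^ n)) (fun f => topCoeff_of_dvd hM)
  have hdeg : ∀ i, (r ^ i).natDegree = 2 * i := fun i => by rw [natDegree_pow, hrdeg, mul_comm]
  have hdeg' : ∀ i, (X * r ^ i).natDegree = 2 * i + 1 := fun i => by
    rw [natDegree_X_mul (hrmon.pow i).ne_zero, hdeg]
  have htop : ∀ i, topCoeff (r ^ n) (r ^ i) = 0 := by
    intro i
    rcases lt_or_ge i n with hi | hi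
    · rw [topCoeff_of_natDegree_lt hM (by rw [hdeg, hdeg]; omega), hdeg]
      exact coeff_eq_zero_of_natDegree_lt (by rw [hdeg]; omega)
    · rw [topCoeff_of_dvd hM (pow_dvd_pow _ hi)]
  have htop' : ∀ i, topCoeff (r ^ n) (X * r ^ i) = if i + 1 = n then 1 else 0 := by
    intro i
    rcases lt_or_ge i n with hi | hi
    · rw [topCoeff_of_natDegree_lt hM (by rw [hdeg, hdeg']; omega), hdeg]
      split_ifs with h1
      · rw [show 2 * n - 1 = (X * r ^ i).natDegree by rw [hdeg']; omega]
        exact monic_X.mul (hrmon.pow i)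
      · exact coeff_eq_zero_of_natDegree_lt (by rw [hdeg']; omega)
    · rw [topCoeff_of_dvd hM (Dvd.dvd.mul_left (pow_dvd_pow _ hi) _), if_neg (by omega)]
  set N := aeval u r with hN
  have hNu : ∀ v, u (u v) = e • u v + (N v - t • v) := fun v => by
    simp [hN, hr, Module.algebraMap_end_apply, pow_two]
  have hNx : (N ^ n) x = 0 := by rw [hN, ← map_pow]; exact hx
  have hNy : (N ^ n) y = 0 := by rw [hN, ← map_pow]; exact hy
  have hiso0 : ∀ v w, b (orbitMap n N x v) (orbitMap n N y w) = 0 := by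
    intro v w
    rw [← zero_mul (revForm F n v w)]
    refine apply_orbitMap_orbitMap (f := LinearMap.id) (fun i j => ?_) v w
    rw [LinearMap.id_apply, hN, ← map_pow, ← map_pow, ← h.apply_aeval_left, ← Module.End.mul_apply,
      ← map_mul, ← pow_add, hxy, htop, ite_self]
  have hiso1 : ∀ v w, b (u (orbitMap n N x v)) (orbitMap n N y w) = revForm F n v w := by
    intro v w
    rw [← one_mul (revForm F n v w)]
    refine apply_orbitMap_orbitMap (fun i j => ?_) v w
    have : u (aeval u (r ^ (i : ℕ)) x) = aeval u (X * r ^ (i : ℕ)) x := by simp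
    rw [hN, ← map_pow, ← map_pow, ← h.apply_aeval_left, this, ← Module.End.mul_apply,
      ← map_mul, mul_left_comm, ← pow_add, hxy, htop', add_comm (j : ℕ)]
  have hiso2 : ∀ v w, b (u (u (orbitMap n N x v))) (orbitMap n N y w) = e * revForm F n v w := by
    intro v w
    rw [hNu, ← orbitMap_shift hNx]
    simp [hiso0, hiso1]
  have hzero : ∀ x v w (i j : ℕ),
      b ((u ^ i) (orbitMap n N x v)) ((u ^ j) (orbitMap n N x w)) = 0 := by
    intro x v w i j
    obtain ⟨f, hf⟩ := exists_orbitMap_eq_aeval u r x v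
    obtain ⟨g, hg⟩ := exists_orbitMap_eq_aeval u r x w
    have : ∀ (k : ℕ) (f : F[X]), (u ^ k) (aeval u f x) = aeval u (X ^ k * f) x := by simp
    rw [hf, hg, this, this, h.apply_aeval_aeval]
  have hz00 := fun x v w => hzero x v w 0 0
  have hz01 := fun x v w => hzero x v w 0 1
  have hz10 := fun x v w => hzero x v w 1 0
  have hz11 := fun x v w => hzero x v w 1 1
  simp only [pow_zero, pow_one, Module.End.one_apply] at hz00 hz01 hz10 hz11
  have hiso1' : ∀ v w, b (orbitMap n N x v) (u (orbitMap n N y w)) = revForm F n v w := by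
    intro v w
    rw [← h.apply_left, hiso1]
  have hiso2' : ∀ v w, b (u (orbitMap n N x v)) (u (orbitMap n N y w)) = e * revForm F n v w := by
    intro v w
    rw [← h.apply_left, hiso2]
  refine ⟨((orbitMap n N x).coprod (u ∘ₗ orbitMap n N x)).coprod
    ((orbitMap n N y).coprod (u ∘ₗ orbitMap n N y)), ?_, ?_⟩
  · rintro ⟨⟨v₁, v₂⟩, v₃, v₄⟩ ⟨⟨w₁, w₂⟩, w₃, w₄⟩
    simp only [LinearMap.coprod_apply, LinearMap.comp_apply, map_add, LinearMap.add_apply, hz00,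
      hz01, hz10, hz11, hiso0, hiso1, hiso1', hiso2', zero_add, add_zero, quadraticForm_apply]
    rw [← h.isAlt.neg_eq (orbitMap n N x w₁), ← h.isAlt.neg_eq (u (orbitMap n N x w₂)),
      ← h.isAlt.neg_eq (orbitMap n N x w₁), ← h.isAlt.neg_eq (u (orbitMap n N x w₂)),
      hiso0, hiso1, hiso1', hiso2', revForm_comm v₃, revForm_comm v₄, revForm_comm v₄]
    ring
  · rintro ⟨⟨v₁, v₂⟩, v₃, v₄⟩
    simp only [LinearMap.coprod_apply, LinearMap.comp_apply, map_add, quadraticEnd_apply,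
      LinearMap.sub_apply, Module.algebraMap_end_apply, map_sub,
      orbitMap_shift hNx, orbitMap_shift hNy, map_smul, hNu]
    abel

theorem hyperbolicForm_separating {n : ℕ} {v : (Fin n → F) × (Fin n → F)}
    (h : ∀ w, hyperbolicForm (revForm F n) v w = 0) : v = 0 := by
  ext1
  · exact revForm_separating fun w => by simpa using h (0, w)
  · exact revForm_separating fun w => by simpa using h (w, 0)

theorem quadraticForm_separating {n : ℕ} {e : F}
    {v : ((Fin n → F) × (Fin n → F)) × ((Fin n → F) × (Fin n → F))}
    (h : ∀ w, quadraticForm (revForm F n) e v w = 0) : v = 0 := by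
  have h2 : v.1.2 = 0 := revForm_separating fun w => by simpa using h ((0, 0), (w, 0))
  have h4 : v.2.2 = 0 := revForm_separating fun w => by simpa using h ((w, 0), (0, 0))
  have h1 : v.1.1 = 0 := revForm_separating fun w => by simpa [h2] using h ((0, 0), (0, w))
  have h3 : v.2.1 = 0 := revForm_separating fun w => by simpa [h4] using h ((0, w), (0, 0))
  exact Prod.ext (Prod.ext h1 h2) (Prod.ext h3 h4)

end Blocks

/-! ### Reconstruction from the Jordan cells -/

section Reconstruction

variable {F : Type*} [Field F]

/-- Every irreducible factor of the minimal polynomial of `u` is either `X - z` with `z` such that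
`X² - l X + c` is the translate by `z` of `X² - m X + d`, or of the form `X² - (l - m) X + t`. -/
def HasExceptionalFactors {V : Type*} [AddCommGroup V] [Module F V] (l c m d : F)
    (u : Module.End F V) : Prop :=
  ∀ r : F[X], r.Monic → Irreducible r → ∀ x : V, x ≠ 0 → aeval u r x = 0 →
    (∃ z, r = X - C z ∧ m + 2 * z = l ∧ z ^ 2 + m * z + d = c) ∨
      ∃ t, r = X ^ 2 - C (l - m) * X + C t

/-- The numbers of Jordan cells of odd sizes are multiples of `4`, for every eigenvalue `z` such
that `X² - l X + c` is the translate by `z` of `X² - m X + d`. -/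
def HasFourfoldCells {V : Type*} [AddCommGroup V] [Module F V] (l c m d : F)
    (u : Module.End F V) : Prop :=
  ∀ z, m + 2 * z = l → z ^ 2 + m * z + d = c → ∀ k, Odd k → 4 ∣ jordanCells u z k

theorem IsQuadraticDifference.hasFourfoldCells {V : Type*} [AddCommGroup V] [Module F V]
    [FiniteDimensional F V] {l c m d : F} {b : LinearMap.BilinForm F V} {u : Module.End F V}
    (hirr : Irreducible (X ^ 2 - C l * X + C c)) (hb : b.IsAlt) (hnd : b.Nondegenerate)
    (halt : ∀ x, b x (u x) = 0) (h : IsQuadraticDifference l c m d b u) :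
    HasFourfoldCells l c m d u := by
  obtain ⟨a, h1, h2, h3⟩ := h
  intro z hl hc k hk
  refine four_dvd_jordanCells hb hnd hirr (by compute_degree!) (u₁ := a)
    (u₂ := a - u + algebraMap F (Module.End F V) z) h1 ?_ rfl ?_ ?_ ?_ hk
  · intro x
    simp [h1, halt, hb.self_eq_zero, Module.algebraMap_end_apply]
  · ext x
    simp [pow_two, h2, Module.algebraMap_end_apply]
  · ext x
    simp only [map_add, map_sub, map_mul, aeval_X, aeval_C, pow_two, LinearMap.add_apply,
      LinearMap.sub_apply (_ * _),
      Module.End.mul_apply, Module.algebraMap_end_apply, h3, map_smul (a - u), LinearMap.zero_apply]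
    rw [← hl, ← hc]
    module
  · abel

theorem coe_aeval_apply {V : Type*} [AddCommGroup V] [Module F V] {V' : Submodule F V}
    {u : Module.End F V} {u' : Module.End F V'} (hu : ∀ y, (u' y : V) = u y) (f : F[X]) (y : V') :
    ((aeval u' f y : V') : V) = aeval u f y := by
  induction f using Polynomial.induction_on generalizing y with
  | C a => simp [Module.algebraMap_end_apply]
  | add f g hf hg => simp [hf, hg]
  | monomial n c ih =>
    rw [pow_succ, ← mul_assoc, map_mul (aeval u') (_ * _), map_mul (aeval u) (_ * _), aeval_X,
      aeval_X, Module.End.mul_apply, Module.End.mul_apply, ih, hu]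

theorem HasExceptionalFactors.restrict {V : Type*} [AddCommGroup V] [Module F V] {l c m d : F}
    {u : Module.End F V} (h : HasExceptionalFactors l c m d u) {V' : Submodule F V}
    {u' : Module.End F V'} (hu : ∀ y, (u' y : V) = u y) : HasExceptionalFactors l c m d u' := by
  intro r hr hirr x hx hrx
  refine h r hr hirr x (by simpa using hx) ?_
  rw [← coe_aeval_apply hu, hrx]; rfl

/-- Splitting off a summand which is a difference: the complement inherits the hypotheses, its
numbers of Jordan cells being controlled by those of the summand. -/
theorem IsQuadraticDifference.of_embedding {V Y : Type*} [AddCommGroup V] [Module F V]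
    [FiniteDimensional F V] [AddCommGroup Y] [Module F Y] [FiniteDimensional F Y] [Nontrivial Y]
    {l c m d : F} (hirr : Irreducible (X ^ 2 - C l * X + C c : F[X]))
    {b : LinearMap.BilinForm F V} {u : Module.End F V} (h : IsSymplecticPair b u)
    (hfac : HasExceptionalFactors l c m d u) (hcells : HasFourfoldCells l c m d u)
    {bX : LinearMap.BilinForm F Y} {uX : Module.End F Y}
    (hsep : ∀ v, (∀ w, bX v w = 0) → v = 0) (Ψ : Y →ₗ[F] V)
    (hΨ : ∀ v w, b (Ψ v) (Ψ w) = bX v w) (hu : ∀ v, u (Ψ v) = Ψ (uX v))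
    (hX : IsQuadraticDifference l c m d bX uX)
    (ih : ∀ (V' : Submodule F V) (u' : Module.End F V'),
      Module.finrank F V' < Module.finrank F V → IsSymplecticPair (b.restrict V') u' →
      HasExceptionalFactors l c m d u' → HasFourfoldCells l c m d u' →
      IsQuadraticDifference l c m d (b.restrict V') u') :
    IsQuadraticDifference l c m d b u := by
  obtain ⟨V', u', e, h', hu', hbe, hue⟩ := h.exists_orthogonal_complement hsep Ψ hΨ hu
  refine hX.of_orthogonal_sum e hbe hue (ih V' u' ?_ h' (hfac.restrict hu') ?_)
  · rw [← e.finrank_eq, Module.finrank_prod]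
    have := Module.finrank_pos (R := F) (M := Y)
    omega
  · have hXalt : bX.IsAlt := fun v => by rw [← hΨ]; exact h.isAlt _
    have hXnd : bX.Nondegenerate := hXalt.isRefl.nondegenerate_iff_separatingLeft.2 hsep
    have hXc := hX.hasFourfoldCells hirr hXalt hXnd
      (fun v => by rw [← hΨ, ← hu]; exact h.alternating _)
    intro z hz1 hz2 k hk
    have h1 := jordanCells_of_equiv_prod e hue z k hk.pos
    have h2 := hcells z hz1 hz2 k hk
    rw [h1] at h2
    exact (Nat.dvd_add_right (hXc z hz1 hz2 k hk)).1 h2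

/-- If no vector of `ker (u - z) ^ n` survives `(u - z) ^ (n - 1)`, there is no Jordan cell of size
`n` for the eigenvalue `z`. -/
theorem jordanCells_eq_zero {V : Type*} [AddCommGroup V] [Module F V] [FiniteDimensional F V]
    {u : Module.End F V} {z : F} {n : ℕ} (hn : 1 ≤ n)
    (h : ∀ x, aeval u ((X - C z) ^ n) x = 0 → aeval u ((X - C z) ^ (n - 1)) x = 0) :
    jordanCells u z n = 0 := by
  have hae : ∀ k, aeval u ((X - C z) ^ k) = (u - algebraMap F (Module.End F V) z) ^ k := by simp
  simp only [hae] at h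
  have h1 : LinearMap.ker ((u - algebraMap F (Module.End F V) z) ^ n) ≤
      LinearMap.ker ((u - algebraMap F (Module.End F V) z) ^ (n - 1)) := h
  have h2 : LinearMap.ker ((u - algebraMap F (Module.End F V) z) ^ (n + 1)) ≤
      LinearMap.ker ((u - algebraMap F (Module.End F V) z) ^ n) := by
    intro x hx
    rw [LinearMap.mem_ker, pow_succ, Module.End.mul_apply] at hx
    have := h _ hx
    rwa [← Module.End.mul_apply, ← pow_succ, Nat.sub_add_cancel hn] at this
  have h3 := Submodule.finrank_mono h1
  have h4 := Submodule.finrank_mono h2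
  have h5 := jordanCells_add u z n hn
  have h6 := finrank_ker_pow_mono (u - algebraMap F (Module.End F V) z) n
  have h7 := finrank_ker_pow_mono (u - algebraMap F (Module.End F V) z) (n - 1)
  rw [Nat.sub_add_cancel hn] at h7
  omega

/-- If the number of Jordan cells of size `n` is a multiple of `4`, a copy of the
double of the Jordan cell of size `n` never comes alone: as that double has two cells of size `n`,
its complement still has at least one. -/
theorem IsSymplecticPair.exists_hyperbolic_embedding_prod {V : Type*} [AddCommGroup V]
    [Module F V] [FiniteDimensional F V] {b : LinearMap.BilinForm F V} {u : Module.End F V}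
    (h : IsSymplecticPair b u) {g : F[X]} {z : F} {n : ℕ} (hn : 1 ≤ n)
    (hg : IsCoprime ((X - C z) ^ n) g) (hu : aeval u ((X - C z) ^ n * g) = 0) {x : V}
    (hx : aeval u ((X - C z) ^ n) x = 0) (hx' : aeval u ((X - C z) ^ (n - 1)) x ≠ 0)
    (hcells : 4 ∣ jordanCells u z n) :
    ∃ Ψ : ((Fin n → F) × (Fin n → F)) × ((Fin n → F) × (Fin n → F)) →ₗ[F] V,
      (∀ v w, b (Ψ v) (Ψ w) = hyperbolicForm (revForm F n) v.1 w.1 +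
        hyperbolicForm (revForm F n) v.2 w.2) ∧
      ∀ v, u (Ψ v) = Ψ ((((shift F n + algebraMap F (Module.End F (Fin n → F)) z).prodMap
        (shift F n + algebraMap F (Module.End F (Fin n → F)) z)).prodMap
        ((shift F n + algebraMap F (Module.End F (Fin n → F)) z).prodMap
        (shift F n + algebraMap F (Module.End F (Fin n → F)) z))) v) := by
  obtain ⟨Ψ, hΨ, hΨu⟩ := h.exists_hyperbolic_embedding hn hg hu hx hx'
  obtain ⟨V', u', e, h', hu', hbe, hue⟩ := h.exists_orthogonal_complement
    (fun v => hyperbolicForm_separating) Ψ hΨ hΨu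
  obtain ⟨y, hy, hy'⟩ : ∃ y, aeval u' ((X - C z) ^ n) y = 0 ∧
      aeval u' ((X - C z) ^ (n - 1)) y ≠ 0 := by
    by_contra! hcon
    rw [jordanCells_of_equiv_prod e hue z n hn, jordanCells_prodMap_shift hn,
      jordanCells_eq_zero hn hcon] at hcells
    omega
  have hu'' : aeval u' ((X - C z) ^ n * g) = 0 := by
    ext y
    rw [coe_aeval_apply hu', hu]; rfl
  obtain ⟨Ψ', hΨ', hΨu'⟩ := h'.exists_hyperbolic_embedding hn hg hu'' hy hy'
  refine ⟨e.toLinearMap ∘ₗ LinearMap.prodMap LinearMap.id Ψ', fun v w => ?_, fun v => ?_⟩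
  · simp only [LinearMap.comp_apply, LinearEquiv.coe_coe, hbe, LinearMap.prodMap_apply,
      LinearMap.id_apply, hΨ']
  · simp only [LinearMap.comp_apply, LinearEquiv.coe_coe, hue, LinearMap.prodMap_apply,
      LinearMap.id_apply, hΨu']

/-- A symplectic pair with exceptional factors is a difference as soon as its numbers of Jordan
cells of odd size are multiples of `4`. A block attached to an irreducible factor `r` of the minimal
polynomial, with maximal exponent `n`, is split off; it is the double of a cyclic
endomorphism, except for a factor of degree `1` and `n` odd, where two such blocks are needed. -/
theorem IsSymplecticPair.isQuadraticDifference {l c m d : F}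
    (hirr : Irreducible (X ^ 2 - C l * X + C c : F[X])) (N : ℕ) :
    ∀ {V : Type*} [AddCommGroup V] [Module F V] [FiniteDimensional F V]
    {b : LinearMap.BilinForm F V} {u : Module.End F V}, Module.finrank F V ≤ N →
    IsSymplecticPair b u → HasExceptionalFactors l c m d u → HasFourfoldCells l c m d u →
    IsQuadraticDifference l c m d b u := by
  induction N with
  | zero =>
    intro V _ _ _ b u hV _ _ _
    have := Module.finrank_zero_iff.1 (Nat.le_zero.1 hV)
    exact ⟨0, fun x => by simp, fun x => Subsingleton.elim _ _, fun x => Subsingleton.elim _ _⟩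
  | succ N ih =>
    intro V _ _ _ b u hV h hfac hcells
    have ih' : ∀ (V' : Submodule F V) (u' : Module.End F V'),
        Module.finrank F V' < Module.finrank F V → IsSymplecticPair (b.restrict V') u' →
        HasExceptionalFactors l c m d u' → HasFourfoldCells l c m d u' →
        IsQuadraticDifference l c m d (b.restrict V') u' :=
      fun V' u' hlt => ih (by omega)
    rcases subsingleton_or_nontrivial V with _ | _
    · exact ⟨0, fun x => by simp, fun x => Subsingleton.elim _ _, fun x => Subsingleton.elim _ _⟩
    have hint : IsIntegral F u := Algebra.IsIntegral.isIntegral u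
    obtain ⟨r, hrmon, hr, hrdvd⟩ := exists_monic_irreducible_factor (minpoly F u)
      (minpoly.not_isUnit F u)
    obtain ⟨g, hmin, hg⟩ := (FiniteMultiplicity.of_not_isUnit hr.not_isUnit
      (minpoly.ne_zero hint)).exists_eq_pow_mul_and_not_dvd
    generalize multiplicity r (minpoly F u) = n at hmin
    have hn : 1 ≤ n := by
      rcases Nat.eq_zero_or_pos n with rfl | hn
      · rw [hmin, pow_zero, one_mul] at hrdvd; exact absurd hrdvd hg
      · exact hn
    have hu : aeval u (r ^ n * g) = 0 := by rw [← hmin, minpoly.aeval]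
    have hcop : IsCoprime (r ^ n) g := (hr.coprime_iff_not_dvd.2 hg).pow_left
    -- such a vector is found in the range of `g (u)`, by minimality of `r ^ n * g`
    obtain ⟨x, hx, hx'⟩ : ∃ x, aeval u (r ^ n) x = 0 ∧ aeval u (r ^ (n - 1)) x ≠ 0 := by
      have hne : aeval u (r ^ (n - 1) * g) ≠ 0 := by
        intro h0
        have h1 := minpoly.dvd F u h0
        have hg0 : g ≠ 0 := by rintro rfl; exact hg (dvd_zero r)
        rw [hmin, mul_dvd_mul_iff_right hg0, pow_dvd_pow_iff hr.ne_zero hr.not_isUnit] at h1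
        omega
      obtain ⟨x, hx⟩ : ∃ x, aeval u (r ^ (n - 1) * g) x ≠ 0 := by
        by_contra! hcon
        exact hne (LinearMap.ext hcon)
      refine ⟨aeval u g x, ?_, ?_⟩
      · rw [← Module.End.mul_apply, ← map_mul, hu, LinearMap.zero_apply]
      · rwa [← Module.End.mul_apply, ← map_mul]
    have : NeZero n := ⟨by omega⟩
    rcases hfac r hrmon hr _ hx' (by
      rw [← Module.End.mul_apply, ← map_mul, ← pow_succ', Nat.sub_add_cancel hn, hx]) with
      ⟨z, rfl, rfl, rfl⟩ | ⟨t, ht⟩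
    · rcases n.even_or_odd with hpar | hpar
      · obtain ⟨Ψ, hΨ, hΨu⟩ := h.exists_hyperbolic_embedding hn hcop hu hx hx'
        exact .of_embedding hirr h hfac hcells (fun v => hyperbolicForm_separating) Ψ hΨ hΨu
          (isQuadraticDifference_hyperbolicForm revForm_comm revForm_shift oddProj_oddProj
            shift_oddProj (revForm_oddProj_of_even hpar)) ih'
      · obtain ⟨Ψ, hΨ, hΨu⟩ := h.exists_hyperbolic_embedding_prod hn hcop hu hx hx'
          (hcells z rfl rfl n hpar)
        refine .of_embedding hirr h hfac hcells (bX := b.compl₁₂ Ψ Ψ) (fun v hv => ?_) Ψ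
          (fun _ _ => rfl) hΨu (isQuadraticDifference_hyperbolicForm_prod revForm_comm revForm_shift
            oddProj_oddProj shift_oddProj (revForm_oddProj_of_odd hpar) hΨ fun v => rfl) ih'
        simp only [LinearMap.compl₁₂_apply, hΨ] at hv
        refine Prod.ext (hyperbolicForm_separating fun w => ?_)
          (hyperbolicForm_separating fun w => ?_)
        · simpa using hv (w, 0)
        · simpa using hv (0, w)
    · obtain ⟨Ψ, hΨ, hΨu⟩ := h.exists_quadratic_embedding hr ht hn hcop hu hx hx'
      refine .of_embedding hirr h hfac hcells (fun v => quadraticForm_separating) Ψ hΨ hΨu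
        (isQuadraticDifference_quadraticForm revForm_comm (fun v w => ?_) l c m d) ih'
      simp [revForm_shift, Module.algebraMap_end_apply]

end Reconstruction

/-! ### Exceptional endomorphisms -/

section Exceptional

variable {F : Type*} [Field F] {K : Type*} [Field K] [Algebra F K]

theorem eq_zero_of_mul_add_eq_zero {x : K} (hx : x ∉ (algebraMap F K).range) {s t : F}
    (h : algebraMap F K s * x + algebraMap F K t = 0) : s = 0 ∧ t = 0 := by
  by_cases hs : s = 0
  · subst hs
    rw [map_zero, zero_mul, zero_add] at h
    exact ⟨rfl, (FaithfulSMul.algebraMap_injective F K) (by rw [h, map_zero])⟩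
  · refine absurd ⟨-t / s, ?_⟩ hx
    have hs' : algebraMap F K s ≠ 0 := by simpa using hs
    rw [map_div₀, map_neg, div_eq_iff hs', neg_eq_iff_add_eq_zero, ← h]
    ring

theorem notMem_range_of_irreducible {p : F[X]} (hirr : Irreducible p) (hdeg : p.natDegree = 2)
    {x : K} (hx : aeval x p = 0) : x ∉ (algebraMap F K).range := by
  rintro ⟨z, rfl⟩
  have : (X - C z) ∣ p := by
    rw [dvd_iff_isRoot, IsRoot, ← (FaithfulSMul.algebraMap_injective F K).eq_iff, map_zero, ← hx,
      aeval_algebraMap_apply, coe_aeval_eq_eval]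
  have h := natDegree_eq_of_degree_eq
    (degree_eq_degree_of_associated ((irreducible_X_sub_C z).associated_of_dvd hirr this))
  rw [natDegree_X_sub_C, hdeg] at h
  omega

theorem aeval_sq_sub_add (x : K) (l c : F) : aeval x (X ^ 2 - C l * X + C c) =
    x ^ 2 - algebraMap F K l * x + algebraMap F K c := by simp

theorem natDegree_sq_sub_add (l c : F) : (X ^ 2 - C l * X + C c).natDegree = 2 := by compute_degree!

theorem monic_sq_sub_add (l c : F) : (X ^ 2 - C l * X + C c).Monic := by monicity!

/-- A difference of roots lying in the base field translates one polynomial into the other. -/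
theorem translate_of_sub_mem {l c m d z : F} (hirr : Irreducible (X ^ 2 - C l * X + C c)) {x y : K}
    (hx : aeval x (X ^ 2 - C l * X + C c) = 0) (hy : aeval y (X ^ 2 - C m * X + C d) = 0)
    (hz : algebraMap F K z = x - y) : m + 2 * z = l ∧ z ^ 2 + m * z + d = c := by
  have hxF := notMem_range_of_irreducible hirr (natDegree_sq_sub_add l c) hx
  rw [aeval_sq_sub_add] at hx hy
  have hy' : y = x - algebraMap F K z := by rw [hz]; ring
  subst hy'
  have h : algebraMap F K (l - m - 2 * z) * x + algebraMap F K (z ^ 2 + m * z + d - c) = 0 := by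
    simp only [map_sub, map_add, map_mul, map_pow, map_ofNat]
    linear_combination hy - hx
  obtain ⟨h1, h2⟩ := eq_zero_of_mul_add_eq_zero hxF h
  exact ⟨by linear_combination -h1, by linear_combination h2⟩

/-- The roots of the fundamental polynomial are the differences of roots. -/
theorem exists_root_sub_of_root_fundamentalPolynomial [IsAlgClosed K] {p q : F[X]} (hp : p.Monic)
    (hq : q.Monic) {ρ : K} (h : aeval ρ (fundamentalPolynomial p q) = 0) :
    ∃ x y : K, aeval x p = 0 ∧ aeval y q = 0 ∧ ρ = x - y := by
  set φ : F[X] →+* K := (aeval ρ : F[X] →ₐ[F] K).toRingHom with hφ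
  have hφC : φ.comp C = algebraMap F K := by ext a; simp [hφ]
  have h1 : (p.map (C : F →+* F[X])).map φ = p.map (algebraMap F K) := by rw [map_map, hφC]
  have h2 : (((q.map (C : F →+* F[X])).comp (X - C X)).map φ) =
      (q.map (algebraMap F K)).comp (X - C ρ) := by
    rw [Polynomial.map_comp, map_map, hφC]; simp [hφ]
  have hd1 : (p.map (C : F →+* F[X])).natDegree = (p.map (algebraMap F K)).natDegree := by
    rw [hp.natDegree_map, hp.natDegree_map]
  have hd2 : ((q.map (C : F →+* F[X])).comp (X - C X)).natDegree =
      ((q.map (algebraMap F K)).comp (X - C ρ)).natDegree := by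
    rw [natDegree_comp, natDegree_comp, hq.natDegree_map, hq.natDegree_map, natDegree_X_sub_C,
      natDegree_X_sub_C]
  have h3 : resultant (p.map (algebraMap F K)) ((q.map (algebraMap F K)).comp (X - C ρ)) = 0 := by
    rw [← hd1, ← hd2, ← h1, ← h2, resultant_map_map]
    exact h
  have h4 := (resultant_eq_zero_iff.1 h3).2
  rw [isCoprime_iff_aeval_ne_zero_of_isAlgClosed K K] at h4
  push Not at h4
  obtain ⟨x, hx, hy⟩ := h4
  refine ⟨x, x - ρ, by simpa using hx, ?_, by ring⟩
  simpa [aeval_comp] using hy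

/-- If `x`, `y` are roots of quadratic polynomials with `y` in `F (x)`, then `x - y` is a root of
some polynomial `X² - (l - m) X + t` with `t` in `F`. -/
theorem exists_aeval_sub_eq_zero {l c m d : F} (hp : Irreducible (X ^ 2 - C l * X + C c))
    (hq : Irreducible (X ^ 2 - C m * X + C d)) {x y : K}
    (hx : aeval x (X ^ 2 - C l * X + C c) = 0) (hy : aeval y (X ^ 2 - C m * X + C d) = 0)
    (hxy : y ∈ IntermediateField.adjoin F {x}) :
    ∃ t, aeval (x - y) (X ^ 2 - C (l - m) * X + C t) = 0 := by
  have hint : IsIntegral F x := ⟨_, monic_sq_sub_add l c, hx⟩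
  obtain ⟨a, b, rfl⟩ : ∃ a b, y = algebraMap F K a * x + algebraMap F K b := by
    rw [← IntermediateField.mem_toSubalgebra,
      IntermediateField.adjoin_simple_toSubalgebra_of_isAlgebraic hint.isAlgebraic,
      Algebra.adjoin_singleton_eq_range_aeval] at hxy
    obtain ⟨f, rfl⟩ := hxy
    have hle : (f %ₘ (X ^ 2 - C l * X + C c)).natDegree ≤ 1 := by
      have := natDegree_modByMonic_lt f (monic_sq_sub_add l c)
        (fun h => by simpa [h] using natDegree_sq_sub_add l c)
      rw [natDegree_sq_sub_add] at this
      omega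
    obtain ⟨a, b, hab⟩ := exists_eq_X_add_C_of_natDegree_le_one hle
    refine ⟨a, b, ?_⟩
    have := aeval_modByMonic_eq_self_of_root (p := f) hx
    rw [hab] at this
    simpa using this.symm
  have hxF := notMem_range_of_irreducible hp (natDegree_sq_sub_add l c) hx
  have hyF := notMem_range_of_irreducible hq (natDegree_sq_sub_add m d) hy
  have ha : a ≠ 0 := by
    rintro rfl
    exact hyF ⟨b, by simp⟩
  rw [aeval_sq_sub_add] at hx hy
  have h : algebraMap F K (a * (2 * b + a * l - m)) * x +
      algebraMap F K (b ^ 2 - a ^ 2 * c - m * b + d) = 0 := by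
    simp only [map_sub, map_add, map_mul, map_pow, map_ofNat]
    linear_combination hy - algebraMap F K a ^ 2 * hx
  have h1 : m = 2 * b + a * l := by
    have := (mul_eq_zero.1 (eq_zero_of_mul_add_eq_zero hxF h).1).resolve_left ha
    linear_combination -this
  refine ⟨c + d - 2 * a * c - l * b, ?_⟩
  rw [aeval_sq_sub_add]
  have h1' := congrArg (algebraMap F K) h1
  simp only [map_sub, map_add, map_mul, map_ofNat] at h1' ⊢
  linear_combination (1 - 2 * algebraMap F K a) * hx + hy + x * h1'

theorem IsExceptional.hasExceptionalFactors {K : Type*} [Field K] [Algebra F K]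
    [IsAlgClosure F K] {V : Type*} [AddCommGroup V] [Module F V] {u : Module.End F V} {l c m d : F}
    (hp : Irreducible (X ^ 2 - C l * X + C c)) (hq : Irreducible (X ^ 2 - C m * X + C d))
    (hsplit : IntermediateField.adjoin F ((X ^ 2 - C l * X + C c).rootSet K) =
      IntermediateField.adjoin F ((X ^ 2 - C m * X + C d).rootSet K))
    (h : IsExceptional (X ^ 2 - C l * X + C c) (X ^ 2 - C m * X + C d) u) :
    HasExceptionalFactors l c m d u := by
  have : IsAlgClosed K := IsAlgClosure.isAlgClosed F
  intro r hrmon hr v hv hrv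
  set f := fundamentalPolynomial (X ^ 2 - C l * X + C c) (X ^ 2 - C m * X + C d) with hf
  obtain ⟨n, hn⟩ : ∃ n : ℕ, aeval u (f ^ n) v = 0 := by
    have hmem : v ∈ ⨆ n : ℕ, LinearMap.ker ((aeval u f) ^ n) := by rw [h]; trivial
    have hdir : Directed (· ≤ ·) fun n : ℕ => LinearMap.ker ((aeval u f) ^ n) := by
      refine Monotone.directed_le (monotone_nat_of_le_succ fun n w hw => ?_)
      rw [LinearMap.mem_ker] at hw ⊢
      rw [pow_succ', Module.End.mul_apply, hw, map_zero]
    obtain ⟨n, hn⟩ := (Submodule.mem_iSup_of_directed _ hdir).1 hmem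
    exact ⟨n, by rw [map_pow]; exact hn⟩
  have hdvd : r ∣ f := by
    have := pow_dvd_of_aeval_apply_eq_zero hr le_rfl (by rwa [pow_one]) (by simpa using hv) hn
    rw [pow_one] at this
    exact hr.prime.dvd_of_dvd_pow this
  obtain ⟨ρ, hρ⟩ := IsAlgClosed.exists_aeval_eq_zero K r (degree_pos_of_irreducible hr).ne'
  have hfρ : aeval ρ f = 0 := by
    obtain ⟨g, hg⟩ := hdvd
    rw [hg, map_mul, hρ, zero_mul]
  obtain ⟨x, y, hx, hy, hxy⟩ := exists_root_sub_of_root_fundamentalPolynomial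
    (monic_sq_sub_add l c) (monic_sq_sub_add m d) hfρ
  have hmin : r = minpoly F ρ := minpoly.eq_of_irreducible_of_monic hr hρ hrmon
  by_cases hρF : ρ ∈ (algebraMap F K).range
  · obtain ⟨z, hz⟩ := hρF
    refine Or.inl ⟨z, ?_, translate_of_sub_mem hp hx hy (hz.trans hxy)⟩
    rw [hmin, ← hz, minpoly.eq_X_sub_C]
  · refine Or.inr ?_
    have hyx : y ∈ IntermediateField.adjoin F {x} := by
      have hy' : y ∈ IntermediateField.adjoin F ((X ^ 2 - C m * X + C d).rootSet K) :=
        IntermediateField.subset_adjoin _ _ (mem_rootSet.2 ⟨(monic_sq_sub_add m d).ne_zero, hy⟩)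
      rw [← hsplit] at hy'
      refine (IntermediateField.adjoin_le_iff.2 fun w hw => ?_) hy'
      have hw' := (mem_rootSet.1 hw).2
      have hxmem := IntermediateField.mem_adjoin_simple_self F x
      rw [aeval_sq_sub_add] at hx hw'
      -- the other root is `l - x`
      have : (w - x) * (w - (algebraMap F K l - x)) = 0 := by linear_combination hw' - hx
      rcases mul_eq_zero.1 this with h1 | h1
      · rw [sub_eq_zero.1 h1]; exact hxmem
      · rw [sub_eq_zero.1 h1]; exact sub_mem (IntermediateField.algebraMap_mem _ l) hxmem
    obtain ⟨t, ht⟩ := exists_aeval_sub_eq_zero hp hq hx hy hyx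
    refine ⟨t, ?_⟩
    have hint : IsIntegral F ρ := ⟨r, hrmon, hρ⟩
    have h2 := (minpoly.two_le_natDegree_iff hint).2 hρF
    rw [hmin]
    refine (eq_of_monic_of_dvd_of_natDegree_le (minpoly.monic hint) (monic_sq_sub_add _ t)
      (minpoly.dvd F ρ (hxy ▸ ht)) ?_).symm ▸ rfl
    rw [natDegree_sq_sub_add]; exact h2

end Exceptional

/-! ### The characterization of symplectic differences -/

theorem isSymplecticDifference_iff_isQuadraticDifference {F V : Type*} [Field F] [AddCommGroup V]
    [Module F V] {b : LinearMap.BilinForm F V} {u : Module.End F V} (h : IsSymplecticPair b u)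
    (l c m d : F) : IsSymplecticDifference (X ^ 2 - C l * X + C c) (X ^ 2 - C m * X + C d) b u ↔
      IsQuadraticDifference l c m d b u := by
  have key : ∀ (a : Module.End F V) (l c : F), aeval a (X ^ 2 - C l * X + C c) = 0 ↔
      ∀ x, a (a x) = l • a x - c • x := by
    intro a l c
    rw [LinearMap.ext_iff]
    refine forall_congr' fun x => ?_
    rw [← sub_eq_zero (a := a (a x))]
    simp only [map_add, map_sub, map_mul, aeval_X, aeval_C, pow_two, LinearMap.add_apply,
      LinearMap.sub_apply, Module.End.mul_apply, Module.algebraMap_end_apply, LinearMap.zero_apply]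
    rw [sub_sub_eq_add_sub, sub_add_eq_add_sub]
  constructor
  · rintro ⟨-, u₁, u₂, h1, -, h3, h4, rfl⟩
    exact ⟨u₁, h1, (key _ _ _).1 h3, by rw [sub_sub_cancel]; exact (key _ _ _).1 h4⟩
  · rintro ⟨a, h1, h2, h3⟩
    exact ⟨h, a, a - u, h1, fun x => by simp [h1, h.alternating], (key _ _ _).2 h2,
      (key _ _ _).2 h3, by rw [sub_sub_cancel]⟩

theorem Polynomial.Monic.exists_eq_quadratic {F : Type*} [Field F] {p : F[X]} (hp : p.Monic)
    (hdeg : p.natDegree = 2) : ∃ l c, p = X ^ 2 - C l * X + C c := by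
  refine ⟨-p.coeff 1, p.coeff 0, ?_⟩
  have h2 : p.coeff 2 = 1 := by rw [← hdeg]; exact hp
  conv_lhs => rw [p.as_sum_range, hdeg]
  simp [Finset.sum_range_succ, h2, ← C_mul_X_pow_eq_monomial]
  ring

theorem mainTheorem1 {F : Type*} [Field F]
    {K : Type*} [Field K] [Algebra F K] [IsAlgClosure F K]
    {V : Type*} [AddCommGroup V] [Module F V] [FiniteDimensional F V]
    (p q : F[X]) (hp : p.Monic) (hq : q.Monic)
    (hp2 : p.natDegree = 2) (hq2 : q.natDegree = 2)
    (hpirr : Irreducible p) (hqirr : Irreducible q)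
    (hsplit : IntermediateField.adjoin F (p.rootSet K) =
      IntermediateField.adjoin F (q.rootSet K))
    (b : LinearMap.BilinForm F V) (u : Module.End F V)
    (hbu : IsSymplecticPair b u) (hexc : IsExceptional p q u) :
    IsSymplecticDifference p q b u ↔
      ∀ z : F, (∃ x ∈ p.rootSet K, ∃ y ∈ q.rootSet K, algebraMap F K z = x - y) →
        ∀ k : ℕ, 1 ≤ k → Odd k → 4 ∣ jordanCells u z k := by
  obtain ⟨l, c, rfl⟩ := hp.exists_eq_quadratic hp2
  obtain ⟨m, d, rfl⟩ := hq.exists_eq_quadratic hq2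
  rw [isSymplecticDifference_iff_isQuadraticDifference hbu]
  constructor
  · rintro h z ⟨x, hx, y, hy, hz⟩ k - hk
    obtain ⟨h1, h2⟩ := translate_of_sub_mem hpirr (mem_rootSet.1 hx).2 (mem_rootSet.1 hy).2 hz
    exact h.hasFourfoldCells hpirr hbu.isAlt hbu.nondegenerate hbu.alternating z h1 h2 k hk
  · intro h
    refine hbu.isQuadraticDifference hpirr _ le_rfl
      (hexc.hasExceptionalFactors (K := K) hpirr hqirr hsplit) fun z h1 h2 k hk => ?_
    have : IsAlgClosed K := IsAlgClosure.isAlgClosed F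
    obtain ⟨x, hx⟩ := IsAlgClosed.exists_aeval_eq_zero K (X ^ 2 - C l * X + C c)
      (degree_pos_of_irreducible hpirr).ne'
    refine h z ⟨x, mem_rootSet.2 ⟨hp.ne_zero, hx⟩, x - algebraMap F K z,
      mem_rootSet.2 ⟨hq.ne_zero, ?_⟩, by ring⟩ k hk.pos hk
    rw [aeval_sq_sub_add] at hx ⊢
    have e1 := congrArg (algebraMap F K) h1
    have e2 := congrArg (algebraMap F K) h2
    simp only [map_add, map_mul, map_pow, map_ofNat] at e1 e2
    linear_combination hx - x * e1 + e2
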